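/- Let $n\ge 3$, let $a_1,\dots,a_n$ be positive integers, and let $0<\theta_1<\dots<\theta_n<\pi$. Put $v_i=(\cos\theta_i,\sin\theta_i)\in\mathbb{R}^2$, let $C=\prod_{i=1}^n[0,a_i]\subset\mathbb{R}^n$ be the cubical complex whose faces are the unit cubes (of all dimensions $0,\dots,n$) with integral vertices, define $\pi:C\to\mathbb{R}^2$ by $\pi(x)=\sum_i x_iv_i$, and let $P=\pi(C)$. A *tiling* is a two-dimensional subcomplex $T\subset C$ such that $\pi:T\to P$ is a homeomorphism. For a 3-face $c=\{I+xe_j+ye_k+ze_\ell : x,y,z\in[0,1]\}$ of $C$ with $j<k<\ell$, the *bottom faces* of $c$ are its three 2-faces containing $I+e_k$, and the *top faces* of $c$ are its three 2-faces containing $I+e_j+e_\ell$. A *downward flip* $T\rightsquigarrow T'$ between tilings replaces, for some such $c$ whose top faces all lie in $T$, the top faces of $c$ by its bottom faces; an *upward flip* is the opposite operation. The *flip graph* has the tilings as vertices and the (upward or downward) flips as edges. The *fundamental forest* of a tiling $T$ is the union of all edges $(I,I+e_j)$ of $T$ with $\pi((I,I+e_j))\not\subset\partial P$ such that $(I,I+e_j)$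 is the only edge of $T$ of the form $(I,I+e_k)$, $1\le k\le n$. Then there is exactly one tiling $T_{\min}$ on which no downward flip can be performed, and $T_{\min}$ is the unique tiling with empty fundamental forest. Moreover, every sequence of downward flips eventually leads to $T_{\min}$: there is no infinite sequence $T_0\rightsquigarrow T_1\rightsquigarrow\cdots$ of downward flips, every finite sequence of downward flips that cannot be continued ends at $T_{\min}$, and every tiling can be joined to $T_{\min}$ by a sequence of downward flips. In particular, the flip graph is connected. -/

import Mathlib

noncomputable section

namespace Zonogon

/-- A face `{I + ∑ i ∈ S, t i • e i | t i ∈ [0, 1]}` of the unit cubical structure on `ℝⁿ`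
with nonnegative integral vertices: `base` is `I`, `dirs` is the set `S` of directions. -/
@[ext]
structure Face (n : ℕ) where
  /-- The lowest vertex `I`. -/
  base : Fin n → ℕ
  /-- The set of directions `S`. -/
  dirs : Finset (Fin n)

namespace Face

variable {n : ℕ}

/-- The dimension of a face. -/
def dim (F : Face n) : ℕ := F.dirs.card

/-- The closed face, as a set of points of `ℝⁿ`. -/
def carrier (F : Face n) : Set (Fin n → ℝ) :=
  {x | ∀ i, (F.base i : ℝ) ≤ x i ∧ x i ≤ (F.base i : ℝ) + (if i ∈ F.dirs then 1 else 0)}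

/-- `F.IsFaceOf G`: `F` is a (not necessarily proper) face of `G`. -/
def IsFaceOf (F G : Face n) : Prop :=
  F.dirs ⊆ G.dirs ∧
    ∀ i, F.base i = G.base i ∨ (i ∈ G.dirs ∧ i ∉ F.dirs ∧ F.base i = G.base i + 1)

/-- `F` is a face of the cubical complex `C = ∏ i, [0, a i]`. -/
def InBox (a : Fin n → ℕ) (F : Face n) : Prop :=
  ∀ i, F.base i + (if i ∈ F.dirs then 1 else 0) ≤ a i

/-- The vertex `I`, as a face of dimension `0`. -/
def vertex (I : Fin n → ℕ) : Face n := ⟨I, ∅⟩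

/-- The edge `(I, I + e_j)`; it points up from `I`. -/
def edge (I : Fin n → ℕ) (j : Fin n) : Face n := ⟨I, {j}⟩

/-- The cube `{I + x e_j + y e_k + z e_l | x, y, z ∈ [0, 1]}`. -/
def cube (I : Fin n → ℕ) (j k l : Fin n) : Face n := ⟨I, {j, k, l}⟩

end Face

variable {n : ℕ}

/-- The box `C = ∏ i, [0, a i]` in `ℝⁿ`. -/
def box (a : Fin n → ℕ) : Set (Fin n → ℝ) := {x | ∀ i, 0 ≤ x i ∧ x i ≤ (a i : ℝ)}

/-- The projection `π(x) = ∑ i, x i • v i`, where `v i = (cos (θ i), sin (θ i))`. -/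
def proj (θ : Fin n → ℝ) (x : Fin n → ℝ) : ℝ × ℝ :=
  (∑ i, x i * Real.cos (θ i), ∑ i, x i * Real.sin (θ i))

/-- The zonogon `P = π(C)`. -/
def zonogon (a : Fin n → ℕ) (θ : Fin n → ℝ) : Set (ℝ × ℝ) := proj θ '' box a

/-- The underlying point set of a collection of faces. -/
def support (X : Set (Face n)) : Set (Fin n → ℝ) := ⋃ F ∈ X, F.carrier

/-- A tiling of `P`: a two-dimensional subcomplex of `C` that `π` maps homeomorphically
onto `P`. -/
@[ext]
structure Tiling (a : Fin n → ℕ) (θ : Fin n → ℝ) where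
  /-- The faces (vertices, edges, squares) of the subcomplex. -/
  faces : Set (Face n)
  inBox : ∀ F ∈ faces, F.InBox a
  closed : ∀ G ∈ faces, ∀ F : Face n, F.IsFaceOf G → F ∈ faces
  dim_le : ∀ F ∈ faces, F.dim ≤ 2
  exists_dim : ∃ F ∈ faces, F.dim = 2
  homeo : ∃ h : Set.MapsTo (proj θ) (support faces) (zonogon a θ),
    IsHomeomorph (Set.MapsTo.restrict (proj θ) (support faces) (zonogon a θ) h)

/-- The subcomplex generated by the two-dimensional faces of `c` that contain the vertex `J`. -/
def facetsAt (c : Face n) (J : Fin n → ℕ) : Set (Face n) :=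
  {F | ∃ G : Face n, G.IsFaceOf c ∧ G.dim = 2 ∧ (Face.vertex J).IsFaceOf G ∧ F.IsFaceOf G}

/-- The three bottom faces of the cube at `I` in directions `j < k < l` (with their edges and
vertices): those that contain `I + e_k`. -/
def bottomFaces (I : Fin n → ℕ) (j k l : Fin n) : Set (Face n) :=
  facetsAt (Face.cube I j k l) (I + Pi.single k 1)

/-- The three top faces of the cube at `I` in directions `j < k < l` (with their edges and
vertices): those that contain `I + e_j + e_l`. -/
def topFaces (I : Fin n → ℕ) (j k l : Fin n) : Set (Face n) :=
  facetsAt (Face.cube I j k l) (I + Pi.single j 1 + Pi.single l 1)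

namespace Tiling

variable {a : Fin n → ℕ} {θ : Fin n → ℝ}

/-- `T'` is obtained from `T` by a downward flip: for some cube of `C`, the tiling `T` contains
its top faces, and `T'` arises by deleting these and replacing them with the bottom faces. -/
def DownwardFlip (T T' : Tiling a θ) : Prop :=
  ∃ (I : Fin n → ℕ) (j k l : Fin n), j < k ∧ k < l ∧ (Face.cube I j k l).InBox a ∧
    topFaces I j k l ⊆ T.faces ∧
    T'.faces = (T.faces \ topFaces I j k l) ∪ bottomFaces I j k l

/-- `T'` is obtained from `T` by an upward flip: for some cube of `C`, the tiling `T` contains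
its bottom faces, and `T'` arises by deleting these and replacing them with the top faces. -/
def UpwardFlip (T T' : Tiling a θ) : Prop :=
  ∃ (I : Fin n → ℕ) (j k l : Fin n), j < k ∧ k < l ∧ (Face.cube I j k l).InBox a ∧
    bottomFaces I j k l ⊆ T.faces ∧
    T'.faces = (T.faces \ bottomFaces I j k l) ∪ topFaces I j k l

/-- The fundamental forest of `T`, given as its set of edges: the internal edges `(I, I + e_j)`
of `T` (those whose image under `π` does not lie in the boundary of `P`) such that
`(I, I + e_j)` is the only edge of `T` pointing up from `I`. -/
def fundamentalForest (T : Tiling a θ) : Set (Face n) :=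
  {E | ∃ (I : Fin n → ℕ) (j : Fin n), E = Face.edge I j ∧ E ∈ T.faces ∧
    ¬ (proj θ '' E.carrier ⊆ frontier (zonogon a θ)) ∧
    ∀ k : Fin n, Face.edge I k ∈ T.faces → k = j}

end Tiling

/-- The flip graph: its vertices are the tilings of `P`, its edges are the flips. -/
def flipGraph (a : Fin n → ℕ) (θ : Fin n → ℝ) : SimpleGraph (Tiling a θ) :=
  SimpleGraph.fromRel fun T T' => T.DownwardFlip T' ∨ T.UpwardFlip T'

end Zonogon

end

/-! A tiling lifts `P` into `C`: two of its points with the same projection are equal. Overlaps are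
therefore excluded by linear relations among the directions. The basic relation is `circuit` on `j <
k < l`, with signs (-, +, -), and every nonzero vector in the kernel of the projection shows
alternating signs at some such triple (`exists_signs_of_proj_eq_zero`).

This sign pattern makes the projection bijective on the lower surface (`bijOn_lowerSurface`), whose
faces of dimension at most two form the candidate minimum `lowestTiling`. A tiling with empty forest
is contained in it: a vertex violating the lower condition either has its only upward edge in the
forest or has a higher neighbour with the same violation (`vertex_lower`). Containment of tilings is
equality (`eq_of_faces_subset`).

A flip exists exactly when the forest is nonempty. The top of a cube has a forest edge at its inner
vertex. Conversely, descending along forest edges ends at a vertex surrounded by three squares, the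
top of a cube (`exists_three_squares`), and exchanging that top for the bottom gives a tiling again
(`exists_downwardFlip`).

Each downward flip replaces one vertex by a lower one, so a height drops (`height_lt`). Hence flips
terminate, and a terminal tiling has empty forest and is the minimum. -/

noncomputable section

namespace Zonogon

/-! ### Faces of the cubical lattice and their relative interiors. -/

namespace Face

variable {n : ℕ}

lemma IsFaceOf.refl (F : Face n) : F.IsFaceOf F :=
  ⟨Finset.Subset.refl _, fun _ => Or.inl rfl⟩

lemma IsFaceOf.trans {F G H : Face n} (h : F.IsFaceOf G) (h' : G.IsFaceOf H) : F.IsFaceOf H := by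
  refine ⟨h.1.trans h'.1, fun i => ?_⟩
  have h1 := @h.1 i
  have h2 := @h'.1 i
  rcases h.2 i with e | ⟨a, b, e⟩ <;> rcases h'.2 i with e' | ⟨a', b', e'⟩
  · exact Or.inl (e.trans e')
  · exact Or.inr ⟨a', fun hh => b' (h1 hh), e.trans e'⟩
  · exact Or.inr ⟨h2 a, b, by omega⟩
  · exact absurd a b'

lemma IsFaceOf.dim_le {F G : Face n} (h : F.IsFaceOf G) : F.dim ≤ G.dim :=
  Finset.card_le_card h.1

lemma IsFaceOf.inBox {a : Fin n → ℕ} {F G : Face n} (h : F.IsFaceOf G) (hG : G.InBox a) :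
    F.InBox a := by
  intro i
  have h1 := @h.1 i
  have h2 := hG i
  rcases h.2 i with e | ⟨a, b, e⟩
  · by_cases hF : i ∈ F.dirs
    · simp only [hF, h1 hF, if_true] at *; omega
    · simp only [hF, if_false]; split_ifs at h2 <;> omega
  · simp only [a, b, if_true, if_false] at *; omega

lemma IsFaceOf.carrier_subset {F G : Face n} (h : F.IsFaceOf G) : F.carrier ⊆ G.carrier := by
  intro x hx i
  have h1 := @h.1 i
  have h2 := hx i
  rcases h.2 i with e | ⟨a, b, e⟩
  · rw [e] at h2
    refine ⟨h2.1, h2.2.trans ?_⟩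
    by_cases hF : i ∈ F.dirs
    · simp [hF, h1 hF]
    · simp only [hF, if_false]; split_ifs <;> linarith
  · simp only [a, b, if_true, if_false, e] at *
    push_cast at h2
    constructor <;> linarith

lemma InBox.carrier_subset {a : Fin n → ℕ} {F : Face n} (h : F.InBox a) : F.carrier ⊆ box a := by
  intro x hx i
  have h1 : ((F.base i + (if i ∈ F.dirs then 1 else 0) : ℕ) : ℝ) ≤ a i := by exact_mod_cast h i
  push_cast at h1
  exact ⟨(Nat.cast_nonneg _).trans (hx i).1, (hx i).2.trans h1⟩

lemma carrier_eq_Icc (F : Face n) : F.carrier =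
    Set.Icc (fun i => (F.base i : ℝ)) (fun i => (F.base i : ℝ) + (if i ∈ F.dirs then 1 else 0)) := by
  ext x
  simp only [carrier, Set.mem_ofPred_eq, Set.mem_Icc, Pi.le_def, forall_and]

/-- The relative interior of a face. -/
def relint (F : Face n) : Set (Fin n → ℝ) :=
  {x | ∀ i, (i ∉ F.dirs → x i = F.base i) ∧
    (i ∈ F.dirs → (F.base i : ℝ) < x i ∧ x i < F.base i + 1)}

lemma relint_subset_carrier (F : Face n) : F.relint ⊆ F.carrier := by
  intro x hx i
  by_cases h : i ∈ F.dirs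
  · simp only [h, if_true]; exact ⟨((hx i).2 h).1.le, ((hx i).2 h).2.le⟩
  · simp [h, (hx i).1 h]

/-- If a relative interior point of `F` lies in `G`, then `F` is a face of `G`. -/
lemma isFaceOf_of_mem_relint {F G : Face n} {x : Fin n → ℝ} (hF : x ∈ F.relint)
    (hG : x ∈ G.carrier) : F.IsFaceOf G := by
  have key : ∀ i, (i ∈ F.dirs → i ∈ G.dirs) ∧
      (F.base i = G.base i ∨ (i ∈ G.dirs ∧ i ∉ F.dirs ∧ F.base i = G.base i + 1)) := by
    intro i
    have hg := hG i
    by_cases h : i ∈ F.dirs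
    · have hf := (hF i).2 h
      by_cases h' : i ∈ G.dirs
      · simp only [h', if_true] at hg
        have h1 : F.base i < G.base i + 1 := by
          exact_mod_cast (show (F.base i : ℝ) < G.base i + 1 by linarith)
        have h2 : G.base i < F.base i + 1 := by
          exact_mod_cast (show (G.base i : ℝ) < F.base i + 1 by linarith)
        exact ⟨fun _ => h', Or.inl (by omega)⟩
      · simp only [h', if_false, add_zero] at hg
        have h1 : F.base i < G.base i := by
          exact_mod_cast (show (F.base i : ℝ) < G.base i by linarith)
        have h2 : G.base i < F.base i + 1 := by
          exact_mod_cast (show (G.base i : ℝ) < F.base i + 1 by linarith)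
        omega
    · have hf := (hF i).1 h
      refine ⟨fun h' => absurd h' h, ?_⟩
      rw [hf] at hg
      have h1 : G.base i ≤ F.base i := by exact_mod_cast hg.1
      by_cases h' : i ∈ G.dirs
      · simp only [h', if_true] at hg
        have h2 : F.base i ≤ G.base i + 1 := by exact_mod_cast hg.2
        rcases h1.eq_or_lt with e | e
        · exact Or.inl e.symm
        · exact Or.inr ⟨h', h, by omega⟩
      · simp only [h', if_false, add_zero] at hg
        have h2 : F.base i ≤ G.base i := by exact_mod_cast hg.2
        exact Or.inl (by omega)
  exact ⟨fun i hi => (key i).1 hi, fun i => (key i).2⟩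

/-- The barycenter of a face. -/
def center (F : Face n) : Fin n → ℝ := fun i => F.base i + (if i ∈ F.dirs then 1 / 2 else 0)

lemma center_mem_relint (F : Face n) : F.center ∈ F.relint := by
  intro i
  constructor <;> intro h <;> simp only [center, h, if_true, if_false, add_zero]
  constructor <;> linarith

/-- The smallest face containing a point with nonnegative coordinates. -/
def minFace (x : Fin n → ℝ) : Face n :=
  ⟨fun i => ⌊x i⌋₊, Finset.univ.filter fun i => x i ≠ ⌊x i⌋₊⟩

lemma mem_relint_minFace {x : Fin n → ℝ} (hx : ∀ i, 0 ≤ x i) : x ∈ (minFace x).relint := by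
  intro i
  simp only [minFace, Finset.mem_filter, Finset.mem_univ, true_and, not_not, imp_self]
  exact fun h => ⟨lt_of_le_of_ne (Nat.floor_le (hx i)) (Ne.symm h), Nat.lt_floor_add_one _⟩

lemma carrier_nonneg {F : Face n} {x : Fin n → ℝ} (hx : x ∈ F.carrier) (i : Fin n) : 0 ≤ x i :=
  (Nat.cast_nonneg _).trans (hx i).1

lemma minFace_isFaceOf {F : Face n} {x : Fin n → ℝ} (hx : x ∈ F.carrier) :
    (minFace x).IsFaceOf F :=
  isFaceOf_of_mem_relint (mem_relint_minFace (carrier_nonneg hx)) hx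

end Face

/-! ### The projection, its linear relations and interior points. -/

variable {n : ℕ}

/-- The projection as a linear map. -/
def projLin (θ : Fin n → ℝ) : (Fin n → ℝ) →ₗ[ℝ] ℝ × ℝ where
  toFun := proj θ
  map_add' x y := by
    simp only [proj, Pi.add_apply, add_mul, Finset.sum_add_distrib, Prod.mk_add_mk]
  map_smul' r x := by
    simp only [proj, Pi.smul_apply, smul_eq_mul, mul_assoc, ← Finset.mul_sum, RingHom.id_apply,
      Prod.smul_mk]

lemma proj_add (θ : Fin n → ℝ) (x y : Fin n → ℝ) : proj θ (x + y) = proj θ x + proj θ y :=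
  (projLin θ).map_add x y

lemma proj_sub (θ : Fin n → ℝ) (x y : Fin n → ℝ) : proj θ (x - y) = proj θ x - proj θ y :=
  (projLin θ).map_sub x y

lemma proj_smul (θ : Fin n → ℝ) (r : ℝ) (x : Fin n → ℝ) : proj θ (r • x) = r • proj θ x :=
  (projLin θ).map_smul r x

lemma proj_single (θ : Fin n → ℝ) (i : Fin n) (r : ℝ) :
    proj θ (Pi.single i r) = (r * Real.cos (θ i), r * Real.sin (θ i)) := by
  simp [proj, Pi.single_apply]

lemma continuous_proj (θ : Fin n → ℝ) : Continuous (proj θ) := by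
  unfold proj; fun_prop

lemma box_eq_Icc (a : Fin n → ℕ) :
    box a = Set.Icc (fun _ => (0 : ℝ)) (fun i => (a i : ℝ)) := by
  ext x; simp only [box, Set.mem_ofPred_eq, Set.mem_Icc, Pi.le_def, forall_and]

lemma convex_box (a : Fin n → ℕ) : Convex ℝ (box a) := by
  rw [box_eq_Icc]; exact convex_Icc _ _

lemma isCompact_box (a : Fin n → ℕ) : IsCompact (box a) := by
  rw [box_eq_Icc]; exact isCompact_Icc

lemma convex_zonogon (a : Fin n → ℕ) (θ : Fin n → ℝ) : Convex ℝ (zonogon a θ) :=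
  (convex_box a).linear_image (projLin θ)

/-- The linear dependency between the directions `j`, `k`, `l`. -/
def circuit (θ : Fin n → ℝ) (j k l : Fin n) : Fin n → ℝ :=
  Pi.single k (Real.sin (θ l - θ j)) - Pi.single j (Real.sin (θ l - θ k)) -
    Pi.single l (Real.sin (θ k - θ j))

lemma proj_circuit (θ : Fin n → ℝ) (j k l : Fin n) : proj θ (circuit θ j k l) = 0 := by
  simp only [circuit, proj_sub, proj_single, Real.sin_sub, Prod.mk_sub_mk]
  ext
  · simp only [Prod.fst_zero]; ring
  · simp only [Prod.snd_zero]; ring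

lemma circuit_mid (θ : Fin n → ℝ) {j k l : Fin n} (h : j < k) (h' : k < l) :
    circuit θ j k l k = Real.sin (θ l - θ j) := by
  simp [circuit, h.ne', h'.ne]

lemma circuit_left (θ : Fin n → ℝ) {j k l : Fin n} (h : j < k) (h' : k < l) :
    circuit θ j k l j = -Real.sin (θ l - θ k) := by
  simp [circuit, h.ne, (h.trans h').ne]

lemma circuit_right (θ : Fin n → ℝ) {j k l : Fin n} (h : j < k) (h' : k < l) :
    circuit θ j k l l = -Real.sin (θ k - θ j) := by
  simp [circuit, h'.ne', (h.trans h').ne']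

lemma circuit_other (θ : Fin n → ℝ) {j k l i : Fin n} (h : i ≠ j) (h' : i ≠ k) (h'' : i ≠ l) :
    circuit θ j k l i = 0 := by
  simp [circuit, h, h', h'']

/-- Directions `0 < θ 0 < θ 1 < ⋯ < π`. -/
structure Admissible (θ : Fin n → ℝ) : Prop where
  mono : StrictMono θ
  pos : ∀ i, 0 < θ i
  lt_pi : ∀ i, θ i < Real.pi

namespace Admissible

variable {θ : Fin n → ℝ} (hθ : Admissible θ)
include hθ

lemma sin_pos (i : Fin n) : 0 < Real.sin (θ i) :=
  Real.sin_pos_of_pos_of_lt_pi (hθ.pos i) (hθ.lt_pi i)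

lemma sin_sub_pos {i j : Fin n} (h : i < j) : 0 < Real.sin (θ j - θ i) :=
  Real.sin_pos_of_pos_of_lt_pi (sub_pos.2 (hθ.mono h)) (by linarith [hθ.pos i, hθ.lt_pi j])

lemma sin_sub_neg {i j : Fin n} (h : i < j) : Real.sin (θ i - θ j) < 0 := by
  rw [← neg_sub, Real.sin_neg]; linarith [hθ.sin_sub_pos h]

/-- A vanishing combination of the directions changes sign at least twice. -/
lemma exists_signs_of_proj_eq_zero {d : Fin n → ℝ} (hd : proj θ d = 0) (hne : d ≠ 0) :
    ∃ j k l : Fin n, j < k ∧ k < l ∧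
      ((0 < d j ∧ d k < 0 ∧ 0 < d l) ∨ (d j < 0 ∧ 0 < d k ∧ d l < 0)) := by
  have main : ∀ d : Fin n → ℝ, proj θ d = 0 → ∀ j, 0 < d j → (∀ i < j, d i = 0) →
      ∃ j k l : Fin n, j < k ∧ k < l ∧ 0 < d j ∧ d k < 0 ∧ 0 < d l := by
    intro d hd j hj hmin
    have hc : ∑ i, d i * Real.cos (θ i) = 0 := congrArg Prod.fst hd
    have hs : ∑ i, d i * Real.sin (θ i) = 0 := congrArg Prod.snd hd
    have hneg : ∃ k, d k < 0 := by
      by_contra! hcon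
      have : 0 < ∑ i, d i * Real.sin (θ i) :=
        Finset.sum_pos' (fun i _ => mul_nonneg (hcon i) (hθ.sin_pos i).le)
          ⟨j, Finset.mem_univ _, mul_pos hj (hθ.sin_pos j)⟩
      linarith
    obtain ⟨k, hk, hkmin⟩ : ∃ k, d k < 0 ∧ ∀ i < k, 0 ≤ d i := by
      obtain ⟨k, hk, hkm⟩ := Finset.exists_min_image (Finset.univ.filter fun i => d i < 0) id
        (by obtain ⟨k, hk⟩ := hneg; exact ⟨k, by simpa using hk⟩)
      refine ⟨k, by simpa using hk, fun i hi => ?_⟩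
      by_contra! hcon
      exact absurd (hkm i (by simpa using hcon)) (not_le.2 hi)
    have hjk : j < k := by
      rcases lt_trichotomy j k with h | h | h
      · exact h
      · subst h; linarith
      · linarith [hmin k h]
    by_cases hl : ∃ l, k < l ∧ 0 < d l
    · obtain ⟨l, hkl, hl⟩ := hl
      exact ⟨j, k, l, hjk, hkl, hj, hk, hl⟩
    · exfalso
      push Not at hl
      -- Pair the relation with the normal of the direction `k`, the first negative entry. If
      -- nothing after `k` is positive, every term is nonnegative and the one at `j` is strictly
      -- positive.
      have hsum : ∑ i, d i * Real.sin (θ k - θ i) = 0 := by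
        calc ∑ i, d i * Real.sin (θ k - θ i)
            = Real.sin (θ k) * ∑ i, d i * Real.cos (θ i) -
              Real.cos (θ k) * ∑ i, d i * Real.sin (θ i) := by
              rw [Finset.mul_sum, Finset.mul_sum, ← Finset.sum_sub_distrib]
              refine Finset.sum_congr rfl fun i _ => ?_
              rw [Real.sin_sub]; ring
          _ = 0 := by rw [hc, hs]; ring
      have : 0 < ∑ i, d i * Real.sin (θ k - θ i) := by
        refine Finset.sum_pos' (fun i _ => ?_)
          ⟨j, Finset.mem_univ _, mul_pos hj (hθ.sin_sub_pos hjk)⟩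
        rcases lt_trichotomy i k with h | h | h
        · exact mul_nonneg (hkmin i h) (hθ.sin_sub_pos h).le
        · simp [h]
        · exact mul_nonneg_of_nonpos_of_nonpos (hl i h) (hθ.sin_sub_neg h).le
      linarith
  obtain ⟨j, hj, hjm⟩ := Finset.exists_min_image (Finset.univ.filter fun i => d i ≠ 0) id
    (by obtain ⟨k, hk⟩ := Function.ne_iff.1 hne; exact ⟨k, by simpa using hk⟩)
  have hmin : ∀ i < j, d i = 0 := by
    intro i hi
    by_contra hcon
    exact absurd (hjm i (by simpa using hcon)) (not_le.2 hi)
  have hj : d j ≠ 0 := by simpa using hj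
  rcases hj.lt_or_gt with h | h
  · obtain ⟨j, k, l, h1, h2, h3, h4, h5⟩ := main (-d)
      (by rw [show -d = (-1 : ℝ) • d by simp, proj_smul, hd, smul_zero]) j (by simpa using h)
      (fun i hi => by simp [hmin i hi])
    simp only [Pi.neg_apply, Left.neg_pos_iff, Left.neg_neg_iff] at h3 h4 h5
    exact ⟨j, k, l, h1, h2, Or.inr ⟨h3, h4, h5⟩⟩
  · obtain ⟨j, k, l, h1, h2, h3⟩ := main d hd j h hmin
    exact ⟨j, k, l, h1, h2, Or.inl h3⟩

/-- If the coordinates `j`, `l` of a point of a box can be decreased and the coordinate `k` can be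
increased, where `j < k < l`, then its projection is interior to the projection of the box. -/
lemma proj_mem_interior {lo hi x : Fin n → ℝ} (hx : x ∈ Set.Icc lo hi) {j k l : Fin n}
    (hjk : j < k) (hkl : k < l) (hj : lo j < x j) (hk : x k < hi k) (hl : lo l < x l) :
    proj θ x ∈ interior (proj θ '' Set.Icc lo hi) := by
  set p := Real.sin (θ l - θ k) with hp
  set q := Real.sin (θ k - θ j) with hq
  set r := Real.sin (θ l - θ j) with hr
  have p0 : 0 < p := hθ.sin_sub_pos hkl
  have q0 : 0 < q := hθ.sin_sub_pos hjk
  have r0 : 0 < r := hθ.sin_sub_pos (hjk.trans hkl)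
  -- The factor 2 leaves room in the coordinates `j` and `l` twice: once for the circuit, once for
  -- the corrections `A` and `B`, bounded by `s * p` and `s * q`.
  obtain ⟨s, s0, hs1, hs2, hs3⟩ : ∃ s > 0, s * r ≤ hi k - x k ∧ 2 * (s * p) ≤ x j - lo j ∧
      2 * (s * q) ≤ x l - lo l := by
    refine ⟨min ((hi k - x k) / r) (min ((x j - lo j) / (2 * p)) ((x l - lo l) / (2 * q))), ?_, ?_, ?_, ?_⟩
    · refine lt_min (div_pos (by linarith) r0) (lt_min (div_pos ?_ ?_) (div_pos ?_ ?_)) <;> linarith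
    · rw [← le_div_iff₀ r0]; exact min_le_left _ _
    · rw [mul_left_comm, ← le_div_iff₀ (by positivity)]
      exact (min_le_right _ _).trans (min_le_left _ _)
    · rw [mul_left_comm, ← le_div_iff₀ (by positivity)]
      exact (min_le_right _ _).trans (min_le_right _ _)
  -- By Cramer's rule, `A z` and `B z` are the coordinates of `z - proj θ x` in the basis of the
  -- directions `j` and `l`.
  let A : ℝ × ℝ → ℝ := fun z => ((z.1 - (proj θ x).1) * Real.sin (θ l) -
    (z.2 - (proj θ x).2) * Real.cos (θ l)) / r
  let B : ℝ × ℝ → ℝ := fun z => ((z.2 - (proj θ x).2) * Real.cos (θ j) -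
    (z.1 - (proj θ x).1) * Real.sin (θ j)) / r
  have hA : Continuous A := by fun_prop
  have hB : Continuous B := by fun_prop
  rw [mem_interior]
  refine ⟨{z | |A z| < s * p} ∩ {z | |B z| < s * q}, ?_,
    (isOpen_lt hA.abs continuous_const).inter (isOpen_lt hB.abs continuous_const), ?_⟩
  · rintro z ⟨h1, h2⟩
    simp only [Set.mem_ofPred_eq, abs_lt] at h1 h2
    refine ⟨x + s • circuit θ j k l + Pi.single j (A z) + Pi.single l (B z), ?_, ?_⟩
    · rw [Set.mem_Icc, Pi.le_def, Pi.le_def, ← forall_and]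
      intro i
      have hxi := And.intro (hx.1 i) (hx.2 i)
      simp only [Pi.add_apply, Pi.smul_apply, smul_eq_mul]
      by_cases ij : i = j
      · subst ij
        rw [circuit_left θ hjk hkl, Pi.single_eq_same,
          Pi.single_eq_of_ne (hjk.trans hkl).ne, ← hp]
        constructor <;> nlinarith
      by_cases il : i = l
      · subst il
        rw [circuit_right θ hjk hkl, Pi.single_eq_same,
          Pi.single_eq_of_ne (hjk.trans hkl).ne', ← hq]
        constructor <;> nlinarith
      rw [Pi.single_eq_of_ne ij, Pi.single_eq_of_ne il]
      by_cases ik : i = k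
      · subst ik
        rw [circuit_mid θ hjk hkl, ← hr]
        have := mul_pos s0 r0
        constructor <;> linarith
      · rw [circuit_other θ ij ik il]; simpa using hxi
    · rw [proj_add, proj_add, proj_add, proj_smul, proj_circuit, proj_single, proj_single]
      have hr' : r = Real.sin (θ l) * Real.cos (θ j) - Real.cos (θ l) * Real.sin (θ j) := by
        rw [hr, Real.sin_sub]
      ext
      · simp only [smul_zero, add_zero, Prod.fst_add, A, B]
        field_simp
        rw [hr']; ring
      · simp only [smul_zero, add_zero, Prod.snd_add, A, B]
        field_simp
        rw [hr']; ring
  · simp only [Set.mem_inter_iff, Set.mem_ofPred_eq, A, B, sub_self, zero_mul, zero_div, abs_zero]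
    exact ⟨by positivity, by positivity⟩

end Admissible

end Zonogon

/-! ### Tilings as lifts of the zonogon; the lower surface and the lowest tiling. -/

namespace Zonogon

variable {n : ℕ}

lemma mem_support {X : Set (Face n)} {x : Fin n → ℝ} :
    x ∈ support X ↔ ∃ F ∈ X, x ∈ F.carrier := by
  simp [support]

lemma finite_inBox (a : Fin n → ℕ) : {F : Face n | F.InBox a}.Finite := by
  refine Set.Finite.subset (((Set.finite_Icc (0 : Fin n → ℕ) a).prod
    (Set.finite_univ (α := Finset (Fin n)))).image fun p => (⟨p.1, p.2⟩ : Face n)) ?_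
  intro F hF
  refine ⟨(F.base, F.dirs), ⟨⟨fun i => Nat.zero_le _, fun i => ?_⟩, Set.mem_univ _⟩, rfl⟩
  exact (Nat.le_add_right _ _).trans (hF i)

namespace Tiling

variable {a : Fin n → ℕ} {θ : Fin n → ℝ}

/-- A tiling from a subcomplex on whose support the projection is bijective. -/
def ofBijOn (faces : Set (Face n)) (inBox : ∀ F ∈ faces, F.InBox a)
    (closed : ∀ G ∈ faces, ∀ F : Face n, F.IsFaceOf G → F ∈ faces)
    (dim_le : ∀ F ∈ faces, F.dim ≤ 2) (exists_dim : ∃ F ∈ faces, F.dim = 2)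
    (bij : Set.BijOn (proj θ) (support faces) (zonogon a θ)) : Tiling a θ where
  faces := faces
  inBox := inBox
  closed := closed
  dim_le := dim_le
  exists_dim := exists_dim
  homeo := by
    refine ⟨bij.mapsTo, ?_⟩
    have hcpt : IsCompact (support faces) := by
      refine Set.Finite.isCompact_biUnion ((finite_inBox a).subset inBox) fun F _ => ?_
      rw [Face.carrier_eq_Icc]; exact isCompact_Icc
    have : CompactSpace (support faces) := isCompact_iff_compactSpace.1 hcpt
    rw [isHomeomorph_iff_continuous_bijective]
    refine ⟨(continuous_proj θ).restrict bij.mapsTo, ?_, ?_⟩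
    · exact (bij.mapsTo.restrict_inj).2 bij.injOn
    · exact (Set.MapsTo.restrict_surjective_iff bij.mapsTo).2 bij.surjOn

variable (T : Tiling a θ)

lemma injOn : Set.InjOn (proj θ) (support T.faces) := by
  obtain ⟨h, hh⟩ := T.homeo
  exact h.restrict_inj.1 hh.injective

lemma surjOn : Set.SurjOn (proj θ) (support T.faces) (zonogon a θ) := by
  obtain ⟨h, hh⟩ := T.homeo
  exact (Set.MapsTo.restrict_surjective_iff h).1 hh.surjective

variable {T}

lemma mem_of_mem_relint {F : Face n} {x : Fin n → ℝ} (hx : x ∈ F.relint)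
    (hT : x ∈ support T.faces) : F ∈ T.faces := by
  obtain ⟨G, hG, hxG⟩ := mem_support.1 hT
  exact T.closed G hG F (Face.isFaceOf_of_mem_relint hx hxG)

lemma eq_of_proj_eq {F G : Face n} (hF : F ∈ T.faces) (hG : G ∈ T.faces) {x y : Fin n → ℝ}
    (hx : x ∈ F.carrier) (hy : y ∈ G.carrier) (h : proj θ x = proj θ y) : x = y :=
  T.injOn (mem_support.2 ⟨F, hF, hx⟩) (mem_support.2 ⟨G, hG, hy⟩) h

/-- The center of a face of `T'` projects to a point covered by `T`. Injectivity on `T'` puts the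
center itself in `T`, and a relative interior point brings its whole face along. -/
lemma eq_of_faces_subset {T T' : Tiling a θ} (h : T.faces ⊆ T'.faces) : T = T' := by
  refine Tiling.ext (h.antisymm fun F hF => ?_)
  have hc : F.center ∈ F.carrier := F.relint_subset_carrier F.center_mem_relint
  have hP : proj θ F.center ∈ zonogon a θ :=
    ⟨_, (T'.inBox F hF).carrier_subset hc, rfl⟩
  obtain ⟨y, hy, hyx⟩ := T.surjOn hP
  obtain ⟨G, hG, hyG⟩ := mem_support.1 hy
  have := eq_of_proj_eq (h hG) hF hyG hc hyx
  subst this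
  exact mem_of_mem_relint F.center_mem_relint hy

/-- Near every point of a tiling whose projection is interior, the tiling contains points
that project to a given direction. -/
lemma exists_near {x : Fin n → ℝ} (hx : x ∈ support T.faces)
    (hint : proj θ x ∈ interior (zonogon a θ)) (w : ℝ × ℝ) {η : ℝ} (hη : 0 < η) :
    ∃ ε : ℝ, 0 < ε ∧ ∃ G ∈ T.faces, ∃ y ∈ G.carrier, (∀ i, |y i - x i| < η) ∧
      proj θ y = proj θ x + ε • w := by
  obtain ⟨h, hh⟩ := T.homeo
  -- The homeomorphism is an open map, so the part of the tiling near `x` covers a relative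
  -- neighbourhood of its projection. Interiority makes short segments from that projection stay in
  -- `P`.
  have hU : IsOpen {y : support T.faces | dist y.1 x < η} :=
    isOpen_lt (by fun_prop) continuous_const
  obtain ⟨V, hV, hVU⟩ := isOpen_induced_iff.1 (hh.isOpenMap _ hU)
  have hxV : proj θ x ∈ V := by
    have : (⟨proj θ x, h hx⟩ : zonogon a θ) ∈ Subtype.val ⁻¹' V := by
      rw [hVU]
      exact ⟨⟨x, hx⟩, by simpa using hη, rfl⟩
    exact this
  have hcont : Filter.Tendsto (fun t : ℝ => proj θ x + t • w) (nhdsWithin 0 (Set.Ioi 0))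
      (nhds (proj θ x)) := by
    refine Filter.Tendsto.mono_left ?_ nhdsWithin_le_nhds
    have : Continuous (fun t : ℝ => proj θ x + t • w) := by fun_prop
    simpa using this.tendsto 0
  have hev := hcont (Filter.inter_mem (hV.mem_nhds hxV) (isOpen_interior.mem_nhds hint))
  obtain ⟨ε, ⟨h1, h2⟩, h3⟩ := 
    Filter.nonempty_of_mem (Filter.inter_mem (Filter.mem_map.1 hev) self_mem_nhdsWithin)
  have : (⟨proj θ x + ε • w, interior_subset h2⟩ : zonogon a θ) ∈ Subtype.val ⁻¹' V := h1
  rw [hVU] at this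
  obtain ⟨⟨y, hy⟩, hyx, hyw⟩ := this
  obtain ⟨G, hG, hyG⟩ := mem_support.1 hy
  refine ⟨ε, h3, G, hG, y, hyG, fun i => ?_, congrArg Subtype.val hyw⟩
  have h4 : dist y x < η := hyx
  exact (dist_le_pi_dist y x i).trans_lt h4

end Tiling

/-- The part of the box that is visible from below: coordinates between two positive ones
are maximal. -/
def lowerSurface (a : Fin n → ℕ) : Set (Fin n → ℝ) :=
  {x | x ∈ box a ∧ ∀ j k l : Fin n, j < k → k < l → 0 < x j → 0 < x l → x k = a k}

lemma sin_add_lt {x y : ℝ} (hx : 0 < x) (hy : 0 < y) (h : x + y < Real.pi) :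
    Real.sin (x + y) < Real.sin x + Real.sin y := by
  have h1 := Real.sin_pos_of_pos_of_lt_pi hx (by linarith)
  have h2 := Real.sin_pos_of_pos_of_lt_pi hy (by linarith)
  have h3 : Real.cos x < 1 := by
    rw [← Real.cos_zero]; exact Real.cos_lt_cos_of_nonneg_of_le_pi le_rfl (by linarith) hx
  have h4 : Real.cos y < 1 := by
    rw [← Real.cos_zero]; exact Real.cos_lt_cos_of_nonneg_of_le_pi le_rfl (by linarith) hy
  rw [Real.sin_add]
  nlinarith

namespace Admissible

variable {θ : Fin n → ℝ} {a : Fin n → ℕ}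

/-- Strict subadditivity of the sine. It makes the coordinate sum a potential that decreases along
circuits. -/
lemma sum_circuit_neg (hθ : Admissible θ) {j k l : Fin n} (hjk : j < k) (hkl : k < l) :
    ∑ i, circuit θ j k l i < 0 := by
  have := sin_add_lt (sub_pos.2 (hθ.mono hkl)) (sub_pos.2 (hθ.mono hjk))
    (by linarith [hθ.pos j, hθ.lt_pi l])
  simp only [circuit, Pi.sub_apply, Finset.sum_sub_distrib, Finset.sum_pi_single',
    Finset.mem_univ, if_true]
  simp only [sub_add_sub_cancel] at this
  linarith

/-- Injectivity: of two points with equal projection, one is larger at `j` and `l` but smaller at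
`k`, so it is not maximal at `k` although it must be. Surjectivity: a point of a fibre minimizing
the coordinate sum is lower, since otherwise a circuit could still be added. -/
lemma bijOn_lowerSurface (hθ : Admissible θ) :
    Set.BijOn (proj θ) (lowerSurface a) (zonogon a θ) := by
  refine ⟨fun x hx => ⟨x, hx.1, rfl⟩, fun x hx y hy hxy => ?_, ?_⟩
  · by_contra hne
    obtain ⟨j, k, l, hjk, hkl, ⟨h1, h2, h3⟩ | ⟨h1, h2, h3⟩⟩ :=
      hθ.exists_signs_of_proj_eq_zero (d := x - y) (by rw [proj_sub, hxy, sub_self])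
        (sub_ne_zero.2 hne) <;> simp only [Pi.sub_apply] at h1 h2 h3
    · have := hx.2 j k l hjk hkl (by linarith [(hy.1 j).1]) (by linarith [(hy.1 l).1])
      linarith [(hy.1 k).2]
    · have := hy.2 j k l hjk hkl (by linarith [(hx.1 j).1]) (by linarith [(hx.1 l).1])
      linarith [(hx.1 k).2]
  · rintro _ ⟨x₀, hx₀, rfl⟩
    have hcpt : IsCompact (box a ∩ {x | proj θ x = proj θ x₀}) :=
      (isCompact_box a).inter_right (isClosed_eq (continuous_proj θ) continuous_const)
    obtain ⟨x, ⟨hxb, hxp⟩, hmin⟩ := hcpt.exists_isMinOn ⟨x₀, hx₀, rfl⟩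
      (f := fun x => ∑ i, x i) (by fun_prop)
    refine ⟨x, ⟨hxb, fun j k l hjk hkl hj hl => ?_⟩, hxp⟩
    by_contra hk
    have hk : x k < a k := lt_of_le_of_ne (hxb k).2 hk
    set p := Real.sin (θ l - θ k) with hp
    set q := Real.sin (θ k - θ j) with hq
    set r := Real.sin (θ l - θ j) with hr
    have p0 : 0 < p := hθ.sin_sub_pos hkl
    have q0 : 0 < q := hθ.sin_sub_pos hjk
    have r0 : 0 < r := hθ.sin_sub_pos (hjk.trans hkl)
    obtain ⟨s, s0, hs1, hs2, hs3⟩ : ∃ s > 0, s * r ≤ a k - x k ∧ s * p ≤ x j ∧ s * q ≤ x l := by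
      refine ⟨min ((a k - x k) / r) (min (x j / p) (x l / q)), ?_, ?_, ?_, ?_⟩
      · exact lt_min (div_pos (by linarith) r0) (lt_min (div_pos hj p0) (div_pos hl q0))
      · rw [← le_div_iff₀ r0]; exact min_le_left _ _
      · rw [← le_div_iff₀ p0]
        exact (min_le_right _ _).trans (min_le_left _ _)
      · rw [← le_div_iff₀ q0]
        exact (min_le_right _ _).trans (min_le_right _ _)
    have hmem : x + s • circuit θ j k l ∈ box a ∩ {x | proj θ x = proj θ x₀} := by
      refine ⟨fun i => ?_, ?_⟩
      · have hi := hxb i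
        simp only [Pi.add_apply, Pi.smul_apply, smul_eq_mul]
        by_cases ij : i = j
        · subst ij
          rw [circuit_left θ hjk hkl, ← hp]
          have := mul_pos s0 p0
          constructor <;> linarith
        by_cases il : i = l
        · subst il
          rw [circuit_right θ hjk hkl, ← hq]
          have := mul_pos s0 q0
          constructor <;> linarith
        by_cases ik : i = k
        · subst ik
          rw [circuit_mid θ hjk hkl, ← hr]
          have := mul_pos s0 r0
          constructor <;> linarith
        · rw [circuit_other θ ij ik il]; simpa using hi
      · rw [Set.mem_ofPred_eq, proj_add, proj_smul, proj_circuit, smul_zero, add_zero]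
        exact hxp
    have hle : ∑ i, x i ≤ ∑ i, (x + s • circuit θ j k l) i := hmin hmem
    simp only [Pi.add_apply, Pi.smul_apply, smul_eq_mul, Finset.sum_add_distrib,
      ← Finset.mul_sum] at hle
    nlinarith [hθ.sum_circuit_neg hjk hkl]

end Admissible

/-- The faces of the box of dimension at most two that lie in the lower surface. -/
def lowerFaces (a : Fin n → ℕ) : Set (Face n) :=
  {F | F.InBox a ∧ F.dim ≤ 2 ∧ F.carrier ⊆ lowerSurface a}

/-- The minimal face of a lower point works. Three fractional directions would include a middle one
that is not maximal. A coordinate positive somewhere on the face is positive at the point, so the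
lower condition passes to the whole face. -/
lemma support_lowerFaces (a : Fin n → ℕ) : support (lowerFaces a) = lowerSurface a := by
  refine Set.Subset.antisymm ?_ fun x hx => ?_
  · intro x hx
    obtain ⟨F, hF, hx⟩ := mem_support.1 hx
    exact hF.2.2 hx
  have hx0 : ∀ i, 0 ≤ x i := fun i => (hx.1 i).1
  have hrel := Face.mem_relint_minFace hx0
  set F := Face.minFace x with hF
  have hbox : F.InBox a := by
    intro i
    by_cases h : i ∈ F.dirs
    · have := ((hrel i).2 h).1.trans_le (hx.1 i).2
      simp only [h, if_true]; exact_mod_cast this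
    · have := (hx.1 i).2
      rw [(hrel i).1 h] at this
      simp only [h, if_false]; exact_mod_cast this
  have hfrac : ∀ i ∈ F.dirs, 0 < x i ∧ x i < a i := by
    intro i hi
    have h1 := (hrel i).2 hi
    refine ⟨(Nat.cast_nonneg _).trans_lt h1.1, h1.2.trans_le ?_⟩
    have := hbox i
    simp only [hi, if_true] at this
    exact_mod_cast this
  refine mem_support.2 ⟨F, ⟨hbox, ?_, fun y hy => ⟨hbox.carrier_subset hy, ?_⟩⟩,
    F.relint_subset_carrier hrel⟩
  · by_contra! hcard
    obtain ⟨j, k, l, hj, hk, hl, hjk, hkl⟩ : ∃ j k l, j ∈ F.dirs ∧ k ∈ F.dirs ∧ l ∈ F.dirs ∧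
        j < k ∧ k < l := by
      have hm := F.dirs.orderEmbOfFin_mem (rfl : F.dirs.card = _)
      have h3 : 2 < F.dirs.card := hcard
      refine ⟨_, _, _, hm ⟨0, by omega⟩, hm ⟨1, by omega⟩, hm ⟨2, by omega⟩, ?_, ?_⟩ <;> simp
    have := hx.2 j k l hjk hkl (hfrac j hj).1 (hfrac l hl).1
    linarith [(hfrac k hk).2]
  · have hpos : ∀ i, 0 < y i → 0 < x i := by
      intro i hi
      by_cases h : i ∈ F.dirs
      · exact (hfrac i h).1
      · have := (hy i).2
        simp only [h, if_false, add_zero] at this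
        rw [(hrel i).1 h]; linarith
    intro j k l hjk hkl hj hl
    have hk := hx.2 j k l hjk hkl (hpos j hj) (hpos l hl)
    have hkF : k ∉ F.dirs := fun h => by linarith [(hfrac k h).2]
    have := hy k
    simp only [hkF, if_false, add_zero] at this
    rw [← hk, (hrel k).1 hkF]
    linarith

/-- The lowest tiling. -/
def lowestTiling (hn : 3 ≤ n) (a : Fin n → ℕ) (ha : ∀ i, 0 < a i) {θ : Fin n → ℝ}
    (hθ : Admissible θ) : Tiling a θ :=
  Tiling.ofBijOn (lowerFaces a) (fun _ hF => hF.1)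
    (fun _ hG _ hFG => ⟨hFG.inBox hG.1, hFG.dim_le.trans hG.2.1,
      hFG.carrier_subset.trans hG.2.2⟩)
    (fun _ hF => hF.2.1)
    (by
      -- In the square at the origin in the first two directions, all other coordinates vanish, so
      -- the largest of three indices never has a positive coordinate.
      have hbox : (⟨0, {⟨0, by omega⟩, ⟨1, by omega⟩}⟩ : Face n).InBox a := by
        intro i
        have := ha i
        simp only [Pi.zero_apply, zero_add]
        split_ifs <;> omega
      have hdim : (⟨0, {⟨0, by omega⟩, ⟨1, by omega⟩}⟩ : Face n).dim = 2 :=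
        Finset.card_pair (by simp [Fin.ext_iff])
      refine ⟨_, ⟨hbox, hdim.le, fun x hx => ⟨hbox.carrier_subset hx, ?_⟩⟩, hdim⟩
      intro j k l hjk hkl _ hl
      have := (hx l).2
      rw [if_neg] at this
      · simp at this; linarith
      · rw [Fin.lt_def] at hjk hkl
        simp only [Finset.mem_insert, Finset.mem_singleton, Fin.ext_iff]
        omega)
    (by rw [support_lowerFaces]; exact hθ.bijOn_lowerSurface)

end Zonogon

/-! ### Local structure of a tiling at interior vertices and edges. -/

namespace Zonogon

variable {n : ℕ}

/-- A lattice point as a point of `ℝⁿ`. -/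
def latticePoint (I : Fin n → ℕ) : Fin n → ℝ := fun i => I i

lemma latticePoint_add_single (I : Fin n → ℕ) (i : Fin n) :
    latticePoint (I + Pi.single i 1) = latticePoint I + Pi.single i 1 := by
  ext t
  simp only [latticePoint, Pi.add_apply, Pi.single_apply]
  split_ifs <;> simp

namespace Face

/-- The two-dimensional face at `I` in directions `i`, `j`. -/
def square (I : Fin n → ℕ) (i j : Fin n) : Face n := ⟨I, {i, j}⟩

lemma square_comm (I : Fin n → ℕ) (i j : Fin n) : square I i j = square I j i := by
  simp [square, Finset.pair_comm]

lemma mem_carrier_edge (I : Fin n → ℕ) (i : Fin n) {s : ℝ} (h0 : 0 ≤ s) (h1 : s ≤ 1) :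
    latticePoint I + Pi.single i s ∈ (edge I i).carrier := by
  intro t
  simp only [latticePoint, edge, Pi.add_apply, Pi.single_apply, Finset.mem_singleton]
  split_ifs <;> constructor <;> linarith

lemma mem_carrier_square (I : Fin n → ℕ) {i j : Fin n} (hij : i ≠ j) {s t : ℝ} (h0 : 0 ≤ s)
    (h1 : s ≤ 1) (h2 : 0 ≤ t) (h3 : t ≤ 1) :
    latticePoint I + Pi.single i s + Pi.single j t ∈ (square I i j).carrier := by
  intro u
  simp only [latticePoint, square, Pi.add_apply, Pi.single_apply, Finset.mem_singleton,
    Finset.mem_insert]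
  by_cases hi : u = i
  · subst hi; simp only [hij, if_true, true_or, if_false]; constructor <;> linarith
  by_cases hj : u = j
  · subst hj; simp only [hi, if_true, or_true, if_false]; constructor <;> linarith
  simp [hi, hj]

lemma latticePoint_mem_edge (I : Fin n → ℕ) (i : Fin n) :
    latticePoint I ∈ (edge I i).carrier := by
  simpa using mem_carrier_edge I i le_rfl zero_le_one

lemma latticePoint_add_mem_edge (I : Fin n → ℕ) (i : Fin n) :
    latticePoint (I + Pi.single i 1) ∈ (edge I i).carrier := by
  rw [latticePoint_add_single]
  exact mem_carrier_edge I i zero_le_one le_rfl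

lemma latticePoint_mem_vertex (I : Fin n → ℕ) : latticePoint I ∈ (vertex I).carrier := by
  intro i; simp [vertex, latticePoint]

lemma edge_isFaceOf_square_left (I : Fin n → ℕ) (i j : Fin n) :
    (edge I i).IsFaceOf (square I i j) :=
  ⟨by simp [edge, square], fun _ => Or.inl rfl⟩

lemma edge_isFaceOf_square_top (I : Fin n → ℕ) {i j : Fin n} (hij : i ≠ j) :
    (edge (I + Pi.single j 1) i).IsFaceOf (square I i j) := by
  refine ⟨by simp [edge, square], fun t => ?_⟩
  by_cases h : t = j
  · subst h; right; simp [edge, square, hij.symm]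
  · left; simp [edge, square, h]

lemma vertex_isFaceOf_edge (I : Fin n → ℕ) (i : Fin n) : (vertex I).IsFaceOf (edge I i) :=
  ⟨by simp [vertex], fun _ => Or.inl rfl⟩

lemma vertex_isFaceOf_edge_top (I : Fin n → ℕ) (i : Fin n) :
    (vertex (I + Pi.single i 1)).IsFaceOf (edge I i) := by
  refine ⟨by simp [vertex], fun t => ?_⟩
  by_cases h : t = i
  · subst h; right; simp [edge, vertex]
  · left; simp [edge, vertex, h]

lemma edge_isFaceOf {I : Fin n → ℕ} {G : Face n} (h : (vertex I).IsFaceOf G) {i : Fin n}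
    (hi : i ∈ G.dirs) (hb : G.base i = I i) : (edge I i).IsFaceOf G := by
  refine ⟨by simpa [edge] using hi, fun t => ?_⟩
  by_cases hti : t = i
  · subst hti; exact Or.inl hb.symm
  · rcases h.2 t with e | ⟨e1, -, e2⟩
    · exact Or.inl e
    · exact Or.inr ⟨e1, by simpa [edge] using hti, e2⟩

/-- A face with a point at distance less than one from a lattice point contains it. -/
lemma vertex_isFaceOf_of_near {G : Face n} {I : Fin n → ℕ} {y : Fin n → ℝ} (hy : y ∈ G.carrier)
    (hn : ∀ i, |y i - I i| < 1) : (vertex I).IsFaceOf G := by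
  refine ⟨by simp [vertex], fun i => ?_⟩
  have h1 := hy i
  have h2 := abs_lt.1 (hn i)
  have h3 : G.base i < I i + 1 := by
    exact_mod_cast (show (G.base i : ℝ) < I i + 1 by linarith)
  by_cases h : i ∈ G.dirs
  · simp only [h, if_true] at h1
    have h4 : I i < G.base i + 2 := by
      exact_mod_cast (show (I i : ℝ) < G.base i + 2 by linarith)
    simp only [vertex, h, true_and, Finset.notMem_empty, not_false_eq_true]
    omega
  · simp only [h, if_false, add_zero] at h1
    have h4 : I i < G.base i + 1 := by
      exact_mod_cast (show (I i : ℝ) < G.base i + 1 by linarith)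
    left; simp only [vertex]; omega

end Face

open Face

namespace Tiling

variable {a : Fin n → ℕ} {θ : Fin n → ℝ} {T : Tiling a θ}

lemma latticePoint_mem_box {I : Fin n → ℕ} (hI : vertex I ∈ T.faces) : latticePoint I ∈ box a :=
  (T.inBox _ hI).carrier_subset (latticePoint_mem_vertex I)

lemma proj_vertex_mem_interior (hθ : Admissible θ) {I : Fin n → ℕ} (hI : vertex I ∈ T.faces)
    {j k l : Fin n} (hjk : j < k) (hkl : k < l) (hj : 0 < I j) (hk : I k < a k) (hl : 0 < I l) :
    proj θ (latticePoint I) ∈ interior (zonogon a θ) := by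
  have := latticePoint_mem_box hI
  rw [box_eq_Icc] at this
  rw [zonogon, box_eq_Icc]
  exact hθ.proj_mem_interior this hjk hkl (by simpa [latticePoint] using hj)
    (by simpa [latticePoint] using hk) (by simpa [latticePoint] using hl)

/-- The tiling contains a point close to `I` that projects vertically above it. All sines are
positive, so some coordinate has grown, and the face containing that point has an edge going up from
`I` in that direction. -/
lemma exists_up_edge (hθ : Admissible θ) {I : Fin n → ℕ} (hI : vertex I ∈ T.faces)
    (hint : proj θ (latticePoint I) ∈ interior (zonogon a θ)) : ∃ i, edge I i ∈ T.faces := by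
  obtain ⟨ε, hε, G, hG, y, hy, hnear, hp⟩ :=
    T.exists_near (mem_support.2 ⟨_, hI, latticePoint_mem_vertex I⟩) hint (0, 1) one_pos
  have hf := vertex_isFaceOf_of_near hy hnear
  have hpos : ∃ i, (I i : ℝ) < y i := by
    by_contra! hcon
    have h2 := congrArg Prod.snd hp
    simp only [proj, latticePoint, Prod.snd_add, Prod.smul_snd, smul_eq_mul, mul_one] at h2
    have : ∑ i, y i * Real.sin (θ i) ≤ ∑ i, (I i : ℝ) * Real.sin (θ i) :=
      Finset.sum_le_sum fun i _ => mul_le_mul_of_nonneg_right (hcon i) (hθ.sin_pos i).le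
    linarith
  obtain ⟨i, hi⟩ := hpos
  have h1 := hy i
  have h2 := abs_lt.1 (hnear i)
  simp only [latticePoint] at h2
  have hdir : i ∈ G.dirs := by
    by_contra h
    simp only [h, if_false, add_zero] at h1
    rcases hf.2 i with e | ⟨e, -⟩
    · have : (I i : ℝ) = G.base i := by exact_mod_cast e
      linarith
    · exact h e
  refine ⟨i, T.closed G hG _ (edge_isFaceOf hf hdir ?_)⟩
  rcases hf.2 i with e | ⟨-, -, e⟩
  · exact e.symm
  · simp only [hdir, if_true] at h1
    have : (I i : ℝ) = G.base i + 1 := by exact_mod_cast e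
    linarith

/-- An internal edge lies in a square of the tiling on either side (given by the sign of `σ`). -/
lemma exists_square {I : Fin n → ℕ} {j : Fin n} (hE : edge I j ∈ T.faces)
    (hint : ∃ p ∈ (edge I j).carrier, proj θ p ∈ interior (zonogon a θ)) {σ : ℝ} (hσ : σ ≠ 0) :
    ∃ m, m ≠ j ∧ ((0 < σ * Real.sin (θ m - θ j) ∧ square I j m ∈ T.faces) ∨
      (σ * Real.sin (θ m - θ j) < 0 ∧
        ∃ B, B + Pi.single m 1 = I ∧ square B j m ∈ T.faces)) := by
  -- The given interior point may be an endpoint. Averaging it with the midpoint of the edge keeps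
  -- the projection interior, by convexity, and stays 1/4 away from both ends.
  obtain ⟨x, t, ht0, ht1, hxt, hx⟩ : ∃ (x : Fin n → ℝ) (t : ℝ), 1 / 4 ≤ t ∧ t ≤ 3 / 4 ∧
      x = latticePoint I + Pi.single j t ∧ proj θ x ∈ interior (zonogon a θ) := by
    obtain ⟨p, hpE, hp⟩ := hint
    have hpj := hpE j
    simp only [edge, Finset.mem_singleton, if_true] at hpj
    have hM := mem_carrier_edge I j (s := 1 / 2) (by norm_num) (by norm_num)
    refine ⟨(1 / 2 : ℝ) • p + (1 / 2 : ℝ) • (latticePoint I + Pi.single j (1 / 2)),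
      1 / 2 * (p j - I j) + 1 / 4, by linarith, by linarith, ?_, ?_⟩
    · ext i
      simp only [latticePoint, Pi.add_apply, Pi.smul_apply, smul_eq_mul, Pi.single_apply]
      by_cases h : i = j
      · subst h; simp only [if_true]; ring
      · have := hpE i
        simp only [edge, Finset.mem_singleton, h, if_false, add_zero] at this
        have : p i = I i := le_antisymm this.2 this.1
        simp only [h, if_false, this]; ring
    · rw [proj_add, proj_smul, proj_smul]
      exact (convex_zonogon a θ).combo_interior_self_mem_interior hp
        ⟨_, (T.inBox _ hE).carrier_subset hM, rfl⟩ (by norm_num) (by norm_num) (by norm_num)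
  have hxS : x ∈ (edge I j).carrier :=
    hxt ▸ mem_carrier_edge I j (by linarith) (by linarith)
  -- Move along `σ` times the direction `j` rotated by a right angle. The radius 1/4 keeps the
  -- coordinate `j` strictly inside the edge.
  obtain ⟨ε, hε, G, hG, y, hy, hnear, hp⟩ :=
    T.exists_near (mem_support.2 ⟨_, hE, hxS⟩) hx
      (-(σ * Real.sin (θ j)), σ * Real.cos (θ j)) (η := 1 / 4) (by norm_num)
  have hxi : ∀ i, i ≠ j → x i = I i := fun i hi => by simp [hxt, latticePoint, hi]
  have hxj : x j = I j + t := by simp [hxt, latticePoint]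
  have hf : (vertex I).IsFaceOf G := by
    refine vertex_isFaceOf_of_near hy fun i => ?_
    have := abs_lt.1 (hnear i)
    rw [abs_lt]
    by_cases h : i = j
    · subst h; rw [hxj] at this; constructor <;> linarith
    · rw [hxi i h] at this; constructor <;> linarith
  have hyj := abs_lt.1 (hnear j)
  rw [hxj] at hyj
  have hGj := hy j
  have hjdir : j ∈ G.dirs ∧ G.base j = I j := by
    rcases hf.2 j with e | ⟨h, -, e⟩
    · have e' : (I j : ℝ) = G.base j := by exact_mod_cast e
      refine ⟨?_, e.symm⟩
      by_contra h
      simp only [h, if_false, add_zero] at hGj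
      linarith
    · have e' : (I j : ℝ) = G.base j + 1 := by exact_mod_cast e
      simp only [h, if_true] at hGj
      linarith
  have hoff : ∀ i, i ∉ G.dirs → y i = I i ∧ G.base i = I i := by
    intro i hi
    have := hy i
    simp only [hi, if_false, add_zero] at this
    rcases hf.2 i with e | ⟨h, -⟩
    · have e' : (I i : ℝ) = G.base i := by exact_mod_cast e
      exact ⟨by rw [e']; exact le_antisymm this.2 this.1, e.symm⟩
    · exact absurd h hi
  -- Pairing with the normal of the direction `j` eliminates the displacement along the edge.
  have hcross : ∀ m, m ≠ j → (∀ i, i ≠ j → i ≠ m → y i = I i) →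
      (y m - I m) * Real.sin (θ m - θ j) = ε * σ := by
    intro m hm h
    have hd : y - x = Pi.single j (y j - x j) + Pi.single m (y m - I m) := by
      ext i
      simp only [Pi.sub_apply, Pi.add_apply, Pi.single_apply]
      by_cases ij : i = j
      · subst ij; simp [hm.symm]
      by_cases im : i = m
      · subst im; simp [ij, hxi i ij]
      simp [ij, im, hxi i ij, h i ij im]
    have h3 : proj θ (y - x) = ε • (-(σ * Real.sin (θ j)), σ * Real.cos (θ j)) := by
      rw [proj_sub, hp]; simp
    rw [hd, proj_add, proj_single, proj_single] at h3
    have h4 := congrArg Prod.fst h3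
    have h5 := congrArg Prod.snd h3
    simp only [Prod.fst_add, Prod.snd_add, Prod.smul_fst, Prod.smul_snd, smul_eq_mul] at h4 h5
    rw [Real.sin_sub]
    linear_combination (-Real.sin (θ j)) * h4 + Real.cos (θ j) * h5 +
      ε * σ * Real.sin_sq_add_cos_sq (θ j)
  have hεσ : ε * σ ≠ 0 := mul_ne_zero hε.ne' hσ
  obtain ⟨m, hm, hmj⟩ : ∃ m ∈ G.dirs, m ≠ j := by
    by_contra! hcon
    have hall : ∀ i, i ≠ j → y i = I i := fun i hi => (hoff i fun h => hi (hcon i h)).1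
    by_cases hex : ∃ m, m ≠ j
    · obtain ⟨m, hm⟩ := hex
      have := hcross m hm fun i hi _ => hall i hi
      rw [hall m hm, sub_self, zero_mul] at this
      exact hεσ this.symm
    · push Not at hex
      have hd : y - x = Pi.single j (y j - x j) := by
        ext i; rw [hex i]; simp
      have h3 : proj θ (y - x) = ε • (-(σ * Real.sin (θ j)), σ * Real.cos (θ j)) := by
        rw [proj_sub, hp]; simp
      rw [hd, proj_single] at h3
      have h4 := congrArg Prod.fst h3
      have h5 := congrArg Prod.snd h3
      simp only [Prod.smul_fst, Prod.smul_snd, smul_eq_mul] at h4 h5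
      apply hεσ
      linear_combination Real.sin (θ j) * h4 - Real.cos (θ j) * h5 -
        ε * σ * Real.sin_sq_add_cos_sq (θ j)
  have hdirs : G.dirs = {j, m} := by
    refine (Finset.eq_of_subset_of_card_le ?_ ?_).symm
    · intro i hi
      rcases Finset.mem_insert.1 hi with h | h
      · exact h ▸ hjdir.1
      · exact (Finset.mem_singleton.1 h) ▸ hm
    · rw [Finset.card_pair hmj.symm]; exact T.dim_le G hG
  have hother : ∀ i, i ≠ j → i ≠ m → y i = I i ∧ G.base i = I i :=
    fun i h1 h2 => hoff i (by simp [hdirs, h1, h2])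
  have hc := hcross m hmj fun i h1 h2 => (hother i h1 h2).1
  have hsin : Real.sin (θ m - θ j) ≠ 0 := fun h => hεσ (by rw [← hc, h, mul_zero])
  have hym := hy m
  simp only [hm, if_true] at hym
  -- One more factor of the sine gives a square, so `σ * sin (θ m - θ j)` has the sign of `y m - I
  -- m`. That sign tells whether the square leaves `I` upwards or downwards in the direction `m`.
  have hσ2 : ε * (σ * Real.sin (θ m - θ j)) = (y m - I m) * Real.sin (θ m - θ j) ^ 2 := by
    rw [← mul_assoc, ← hc]; ring
  have hsq : 0 < Real.sin (θ m - θ j) ^ 2 := by positivity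
  have hne : y m - I m ≠ 0 := fun h => hεσ (by rw [← hc, h, zero_mul])
  refine ⟨m, hmj, ?_⟩
  rcases hf.2 m with e | ⟨-, -, e⟩
  · left
    have e' : (I m : ℝ) = G.base m := by exact_mod_cast e
    have hpos : 0 < y m - I m := lt_of_le_of_ne (by linarith) hne.symm
    refine ⟨?_, ?_⟩
    · have := mul_pos hpos hsq
      rw [← hσ2] at this
      exact (mul_pos_iff_of_pos_left hε).1 this
    · have : G = square I j m := by
        refine Face.ext (funext fun i => ?_) hdirs
        by_cases ij : i = j
        · subst ij; exact hjdir.2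
        by_cases im : i = m
        · subst im; exact e.symm
        exact (hother i ij im).2
      rwa [← this]
  · right
    have e0 : I m = G.base m + 1 := e
    have e' : (I m : ℝ) = G.base m + 1 := by exact_mod_cast e
    have hneg : y m - I m < 0 := lt_of_le_of_ne (by linarith) hne
    refine ⟨?_, G.base, ?_, ?_⟩
    · have := mul_neg_of_neg_of_pos hneg hsq
      rw [← hσ2] at this
      by_contra! h
      linarith [mul_nonneg hε.le h]
    · funext i
      by_cases im : i = m
      · subst im; simp [e0]
      by_cases ij : i = j
      · subst ij; simp [im, hjdir.2]
      simp [im, (hother i ij im).2]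
    · have : G = square G.base j m := Face.ext rfl hdirs
      rwa [← this]

end Tiling

end Zonogon

/-! ### Forest edges, their descent, and tilings with empty forest. -/

namespace Zonogon

variable {n : ℕ}

open Face

namespace Tiling

variable {a : Fin n → ℕ} {θ : Fin n → ℝ} {T : Tiling a θ}

/-- Two points of a tiling do not differ by a circuit. -/
lemma false_of_add_circuit (hθ : Admissible θ) {F G : Face n} (hF : F ∈ T.faces)
    (hG : G ∈ T.faces) {j k l : Fin n} (hjk : j < k) (hkl : k < l) {x y : Fin n → ℝ}
    (hx : x ∈ F.carrier) (hy : y ∈ G.carrier) (h : y = x + circuit θ j k l) : False := by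
  have hxy : x = y := eq_of_proj_eq hF hG hx hy (by rw [h, proj_add, proj_circuit, add_zero])
  have h1 := congrFun h k
  rw [← hxy, Pi.add_apply, circuit_mid θ hjk hkl] at h1
  linarith [hθ.sin_sub_pos (hjk.trans hkl)]

/-- No edge goes up from a vertex through a square to the right of the upper edge `d`. -/
lemma no_edge_of_square_right (hθ : Admissible θ) {B : Fin n → ℕ} {i d e : Fin n} (hid : i < d)
    (hde : d < e) (hS : square B d e ∈ T.faces)
    (hE : edge (B + Pi.single e 1) i ∈ T.faces) : False := by
  have p0 := hθ.sin_sub_pos hde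
  have q0 := hθ.sin_sub_pos hid
  have r0 := hθ.sin_sub_pos (hid.trans hde)
  -- The coefficients of the circuit are sines in `[0, 1]`, so they serve as positions on the unit
  -- edge and in the unit square; the two points then differ by exactly the circuit.
  refine false_of_add_circuit hθ hE hS hid hde
    (mem_carrier_edge _ _ p0.le (Real.sin_le_one _))
    (mem_carrier_square B hde.ne r0.le (Real.sin_le_one _)
      (t := 1 - Real.sin (θ d - θ i)) (by linarith [Real.sin_le_one (θ d - θ i)])
      (by linarith)) ?_
  rw [latticePoint_add_single, circuit, Pi.single_sub]
  abel

/-- No edge goes up from a vertex through a square to the left of the upper edge `d`. -/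
lemma no_edge_of_square_left (hθ : Admissible θ) {B : Fin n → ℕ} {f d i : Fin n} (hfd : f < d)
    (hdi : d < i) (hS : square B f d ∈ T.faces)
    (hE : edge (B + Pi.single f 1) i ∈ T.faces) : False := by
  have p0 := hθ.sin_sub_pos hdi
  have q0 := hθ.sin_sub_pos hfd
  have r0 := hθ.sin_sub_pos (hfd.trans hdi)
  refine false_of_add_circuit hθ hE hS hfd hdi
    (mem_carrier_edge _ _ q0.le (Real.sin_le_one _))
    (mem_carrier_square B hfd.ne (s := 1 - Real.sin (θ i - θ d))
      (by linarith [Real.sin_le_one (θ i - θ d)]) (by linarith) r0.le (Real.sin_le_one _)) ?_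
  rw [latticePoint_add_single, circuit, Pi.single_sub]
  abel

/-- At the common endpoint `B + e_d` the square fills the angle counterclockwise from `-v_d` to
`v_j`. For `d < m` the downward edge, in direction `-v_m`, would run into it. -/
lemma not_lt_of_square_right (hθ : Admissible θ) {B B' : Fin n → ℕ} {j d m : Fin n} (hjd : j < d)
    (hB : B + Pi.single d 1 = B' + Pi.single m 1) (hS : square B j d ∈ T.faces)
    (hE : edge B' m ∈ T.faces) : ¬ d < m := by
  intro hdm
  have p0 := hθ.sin_sub_pos hdm
  have q0 := hθ.sin_sub_pos hjd
  have r0 := hθ.sin_sub_pos (hjd.trans hdm)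
  refine false_of_add_circuit hθ hS hE hjd hdm
    (mem_carrier_square B hjd.ne p0.le (Real.sin_le_one _) (t := 1 - Real.sin (θ m - θ j))
      (by linarith [Real.sin_le_one (θ m - θ j)]) (by linarith))
    (mem_carrier_edge B' m (s := 1 - Real.sin (θ d - θ j))
      (by linarith [Real.sin_le_one (θ d - θ j)]) (by linarith)) ?_
  have h := congrArg latticePoint hB
  rw [latticePoint_add_single, latticePoint_add_single] at h
  rw [circuit, Pi.single_sub, Pi.single_sub, ← add_sub_assoc, ← h]
  abel

lemma not_lt_of_square_left (hθ : Admissible θ) {B B' : Fin n → ℕ} {j d m : Fin n} (hdj : d < j)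
    (hB : B + Pi.single d 1 = B' + Pi.single m 1) (hS : square B d j ∈ T.faces)
    (hE : edge B' m ∈ T.faces) : ¬ m < d := by
  intro hmd
  have p0 := hθ.sin_sub_pos hdj
  have q0 := hθ.sin_sub_pos hmd
  have r0 := hθ.sin_sub_pos (hmd.trans hdj)
  refine false_of_add_circuit hθ hS hE hmd hdj
    (mem_carrier_square B hdj.ne (s := 1 - Real.sin (θ j - θ m))
      (by linarith [Real.sin_le_one (θ j - θ m)]) (by linarith) q0.le (Real.sin_le_one _))
    (mem_carrier_edge B' m (s := 1 - Real.sin (θ j - θ d))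
      (by linarith [Real.sin_le_one (θ j - θ d)]) (by linarith)) ?_
  have h := congrArg latticePoint hB
  rw [latticePoint_add_single, latticePoint_add_single] at h
  rw [circuit, Pi.single_sub, Pi.single_sub, ← add_sub_assoc, ← h]
  abel

/-- The value `σ = -1` selects the clockwise normal. A square on that side either has `I` as its
lowest vertex or has `I` as its left vertex. -/
lemma exists_square_right (hθ : Admissible θ) {I : Fin n → ℕ} {j : Fin n}
    (hE : edge I j ∈ T.faces)
    (hint : ∃ p ∈ (edge I j).carrier, proj θ p ∈ interior (zonogon a θ)) :
    (∃ m, m < j ∧ square I m j ∈ T.faces) ∨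
      ∃ m, j < m ∧ ∃ B, B + Pi.single m 1 = I ∧ square B j m ∈ T.faces := by
  obtain ⟨m, hmj, ⟨hs, hS⟩ | ⟨hs, B, hB, hS⟩⟩ := exists_square hE hint
    (σ := -1) (by norm_num)
  · left
    rcases hmj.lt_or_gt with h | h
    · exact ⟨m, h, square_comm I j m ▸ hS⟩
    · linarith [hθ.sin_sub_pos h]
  · right
    rcases hmj.lt_or_gt with h | h
    · linarith [hθ.sin_sub_neg h]
    · exact ⟨m, h, B, hB, hS⟩

lemma exists_square_left (hθ : Admissible θ) {I : Fin n → ℕ} {j : Fin n}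
    (hE : edge I j ∈ T.faces)
    (hint : ∃ p ∈ (edge I j).carrier, proj θ p ∈ interior (zonogon a θ)) :
    (∃ m, j < m ∧ square I j m ∈ T.faces) ∨
      ∃ m, m < j ∧ ∃ B, B + Pi.single m 1 = I ∧ square B m j ∈ T.faces := by
  obtain ⟨m, hmj, ⟨hs, hS⟩ | ⟨hs, B, hB, hS⟩⟩ := exists_square hE hint
    (σ := 1) (by norm_num)
  · left
    rcases hmj.lt_or_gt with h | h
    · linarith [hθ.sin_sub_neg h]
    · exact ⟨m, h, hS⟩
  · right
    rcases hmj.lt_or_gt with h | h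
    · exact ⟨m, h, B, hB, square_comm B j m ▸ hS⟩
    · linarith [hθ.sin_sub_pos h]

/-- The edge `(I, I + e_j)` is the upper edge at `I` of two squares whose other edges at `I`
point down. -/
def IsForestEdge (T : Tiling a θ) (I : Fin n → ℕ) (j : Fin n) : Prop :=
  (∃ m, j < m ∧ ∃ B, B + Pi.single m 1 = I ∧ square B j m ∈ T.faces) ∧
    ∃ m, m < j ∧ ∃ B, B + Pi.single m 1 = I ∧ square B m j ∈ T.faces

lemma exists_proj_mem_interior {I : Fin n → ℕ} {j : Fin n} (hE : edge I j ∈ T.faces)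
    (h : ¬ (proj θ '' (edge I j).carrier ⊆ frontier (zonogon a θ))) :
    ∃ p ∈ (edge I j).carrier, proj θ p ∈ interior (zonogon a θ) := by
  obtain ⟨_, ⟨p, hp, rfl⟩, hf⟩ := Set.not_subset.1 h
  refine ⟨p, hp, ?_⟩
  by_contra hcon
  exact hf ⟨subset_closure ⟨p, (T.inBox _ hE).carrier_subset hp, rfl⟩, hcon⟩

lemma not_subset_frontier {I : Fin n → ℕ} {j : Fin n}
    (h : proj θ (latticePoint I) ∈ interior (zonogon a θ)) :
    ¬ (proj θ '' (edge I j).carrier ⊆ frontier (zonogon a θ)) := fun hs =>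
  (hs ⟨_, latticePoint_mem_edge I j, rfl⟩).2 h

namespace IsForestEdge

variable {I : Fin n → ℕ} {j : Fin n}

lemma edge_mem (h : T.IsForestEdge I j) : edge I j ∈ T.faces := by
  obtain ⟨⟨m, hm, B, rfl, hS⟩, -⟩ := h
  exact T.closed _ hS _ (edge_isFaceOf_square_top B hm.ne)

lemma vertex_mem (h : T.IsForestEdge I j) : vertex I ∈ T.faces :=
  T.closed _ h.edge_mem _ (vertex_isFaceOf_edge I j)

lemma proj_mem_interior (hθ : Admissible θ) (h : T.IsForestEdge I j) :
    proj θ (latticePoint I) ∈ interior (zonogon a θ) := by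
  have hE := T.inBox _ h.edge_mem j
  have hV := h.vertex_mem
  obtain ⟨⟨m, hm, B, hB, -⟩, m', hm', B', hB', -⟩ := h
  refine proj_vertex_mem_interior hθ hV hm' hm ?_ ?_ ?_
  · simp [← hB']
  · simp only [edge, Finset.mem_singleton, if_true] at hE; omega
  · simp [← hB]

/-- Any other upward edge at `I` would cut into the square on the right or the one on the left. -/
lemma eq_of_edge_mem (hθ : Admissible θ) (h : T.IsForestEdge I j) {i : Fin n}
    (hi : edge I i ∈ T.faces) : i = j := by
  obtain ⟨⟨m, hm, B, hB, hS⟩, m', hm', B', hB', hS'⟩ := h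
  rcases lt_trichotomy i j with hij | hij | hij
  · rw [← hB] at hi
    exact (no_edge_of_square_right hθ hij hm hS hi).elim
  · exact hij
  · rw [← hB'] at hi
    exact (no_edge_of_square_left hθ hm' hij hS' hi).elim

lemma mem_fundamentalForest (hθ : Admissible θ) (h : T.IsForestEdge I j) :
    edge I j ∈ T.fundamentalForest :=
  ⟨I, j, rfl, h.edge_mem, not_subset_frontier (h.proj_mem_interior hθ),
    fun _ hk => h.eq_of_edge_mem hθ hk⟩

end IsForestEdge

/-- A neighbouring square with lowest vertex `I` would contribute a second upward edge, so on each
side the other kind of square occurs. -/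
lemma isForestEdge_of_unique (hθ : Admissible θ) {I : Fin n → ℕ} {j : Fin n}
    (hE : edge I j ∈ T.faces)
    (hint : ∃ p ∈ (edge I j).carrier, proj θ p ∈ interior (zonogon a θ))
    (hu : ∀ k, edge I k ∈ T.faces → k = j) : T.IsForestEdge I j := by
  constructor
  · rcases exists_square_right hθ hE hint with ⟨m, hm, hS⟩ | h
    · exact absurd (hu m (T.closed _ hS _ (edge_isFaceOf_square_left I m j))) hm.ne
    · exact h
  · rcases exists_square_left hθ hE hint with ⟨m, hm, hS⟩ | h
    · rw [square_comm] at hS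
      exact absurd (hu m (T.closed _ hS _ (edge_isFaceOf_square_left I m j))) hm.ne'
    · exact h

/-- A forest edge of minimal height is the interior upper edge of the top of a cube. -/
lemma exists_three_squares (hθ : Admissible θ) : ∀ (N : ℕ) {I : Fin n → ℕ} {j : Fin n},
    ∑ i, I i = N → T.IsForestEdge I j → ∃ (B : Fin n → ℕ) (j k l : Fin n), j < k ∧ k < l ∧
      T.IsForestEdge (B + Pi.single j 1 + Pi.single l 1) k ∧
      square B j l ∈ T.faces ∧ square (B + Pi.single j 1) k l ∈ T.faces ∧
      square (B + Pi.single l 1) j k ∈ T.faces := by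
  intro N
  induction N using Nat.strong_induction_on with
  | _ N ih =>
  intro I j hN hF
  have hF' := hF
  obtain ⟨⟨m, hm, B, hB, hS⟩, m', hm', B', hB', hS'⟩ := hF
  have hdown : ∀ d D, D + Pi.single d 1 = I → ∃ p ∈ (edge D d).carrier,
      proj θ p ∈ interior (zonogon a θ) := by
    rintro d D rfl
    exact ⟨_, latticePoint_add_mem_edge D d, hF'.proj_mem_interior hθ⟩
  have hEm : edge B m ∈ T.faces := by
    rw [square_comm] at hS
    exact T.closed _ hS _ (edge_isFaceOf_square_left B m j)
  have hEm' : edge B' m' ∈ T.faces := T.closed _ hS' _ (edge_isFaceOf_square_left B' m' j)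
  -- A third downward edge at `I` is again a forest edge, and a lower one. A square beside it that
  -- has a second upward edge at its bottom would contain the edge `(I, I + e_j)` and overlap one of
  -- the two given squares.
  by_cases hd : ∃ d D, D + Pi.single d 1 = I ∧ edge D d ∈ T.faces ∧ d ≠ m ∧ d ≠ m'
  · obtain ⟨d, D, hD, hE, hdm, hdm'⟩ := hd
    have hlt : ∑ i, D i < N := by
      rw [← hN, ← hD]
      simp [Finset.sum_add_distrib]
    refine ih _ hlt (I := D) (j := d) rfl ⟨?_, ?_⟩
    · rcases exists_square_right hθ hE (hdown d D hD) with ⟨e, he, hSe⟩ | h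
      · have : e = j := by
          refine hF'.eq_of_edge_mem hθ ?_
          rw [← hD]
          exact T.closed _ hSe _ (edge_isFaceOf_square_top D he.ne)
        subst this
        exfalso
        rcases hdm.lt_or_gt with h | h
        · exact not_lt_of_square_right hθ he (hD.trans hB.symm) hSe hEm h
        · exact not_lt_of_square_right hθ hm (hB.trans hD.symm) hS hE h
      · exact h
    · rcases exists_square_left hθ hE (hdown d D hD) with ⟨e, he, hSe⟩ | h
      · have : e = j := by
          refine hF'.eq_of_edge_mem hθ ?_
          rw [← hD]
          rw [square_comm] at hSe
          exact T.closed _ hSe _ (edge_isFaceOf_square_top D he.ne')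
        subst this
        exfalso
        rcases hdm'.lt_or_gt with h | h
        · exact not_lt_of_square_left hθ hm' (hB'.trans hD.symm) hS' hE h
        · exact not_lt_of_square_left hθ he (hD.trans hB'.symm) hSe hEm' h
      · exact h
  · push Not at hd
    -- Only `m` and `m'` lead down from `I`. The square to the left of the edge `(B, B + e_m)` must
    -- then close the gap between them; it is the third square.
    rcases exists_square_left hθ hEm (hdown m B hB) with ⟨f, hf, hSf⟩ | ⟨f, hf, C, hC, hSf⟩
    · have : f = j := by
        refine hF'.eq_of_edge_mem hθ ?_
        rw [← hB]
        rw [square_comm] at hSf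
        exact T.closed _ hSf _ (edge_isFaceOf_square_top B hf.ne')
      exact absurd (this ▸ hf) hm.asymm
    · have hfI : C + Pi.single m 1 + Pi.single f 1 = I := by
        rw [← hB, ← hC]; exact add_right_comm _ _ _
      have hfm : f = m' := hd f (C + Pi.single m 1) hfI
        (T.closed _ hSf _ (edge_isFaceOf_square_top C hf.ne)) hf.ne
      subst hfm
      have hB'C : B' = C + Pi.single m 1 := add_right_cancel (hB'.trans hfI.symm)
      subst hC
      refine ⟨C, f, j, m, hm', hm, ?_, hSf, hS, hB'C ▸ hS'⟩
      rwa [hB]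

/-- A tiling with empty fundamental forest has only vertices on the lower surface. -/
lemma vertex_lower (hθ : Admissible θ) (hT : T.fundamentalForest = ∅) :
    ∀ (N : ℕ) {I : Fin n → ℕ}, (∑ i, a i) - (∑ i, I i) = N → vertex I ∈ T.faces →
      ∀ j k l : Fin n, j < k → k < l → 0 < I j → 0 < I l → I k = a k := by
  intro N
  induction N using Nat.strong_induction_on with
  | _ N ih =>
  intro I hN hI j k l hjk hkl hj hl
  by_contra hk
  have hle : ∀ {I : Fin n → ℕ}, vertex I ∈ T.faces → ∀ i, I i ≤ a i := fun hI i => by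
    simpa [vertex] using T.inBox _ hI i
  have hk : I k < a k := lt_of_le_of_ne (hle hI k) hk
  have hint := proj_vertex_mem_interior hθ hI hjk hkl hj hk hl
  -- An upward edge in another direction would lead to a higher vertex with the same violation at
  -- `k`.
  have hup : ∀ m, edge I m ∈ T.faces → m = k := by
    intro m hm
    by_contra hmk
    have hV := T.closed _ hm _ (vertex_isFaceOf_edge_top I m)
    have hsum : ∑ i, (I + Pi.single m 1 : Fin n → ℕ) i = (∑ i, I i) + 1 := by
      simp [Finset.sum_add_distrib]
    have hsle : ∑ i, (I + Pi.single m 1 : Fin n → ℕ) i ≤ ∑ i, a i :=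
      Finset.sum_le_sum fun i _ => hle hV i
    have := ih ((∑ i, a i) - ∑ i, (I + Pi.single m 1 : Fin n → ℕ) i) (by omega) rfl hV j k l hjk hkl
      (by simp only [Pi.add_apply]; omega) (by simp only [Pi.add_apply]; omega)
    rw [Pi.add_apply, Pi.single_eq_of_ne (Ne.symm hmk), add_zero] at this
    omega
  obtain ⟨m, hm⟩ := exists_up_edge hθ hI hint
  have hmk := hup m hm
  subst hmk
  have : edge I m ∈ T.fundamentalForest := ⟨I, m, rfl, hm, not_subset_frontier hint, hup⟩
  rw [hT] at this
  exact this

lemma faces_subset_lowerFaces (hθ : Admissible θ) (hT : T.fundamentalForest = ∅) :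
    T.faces ⊆ lowerFaces a := by
  intro F hF
  refine ⟨T.inBox F hF, T.dim_le F hF, fun x hx => ⟨(T.inBox F hF).carrier_subset hx, ?_⟩⟩
  intro j k l hjk hkl hj hl
  by_contra hk
  have hk : x k < a k := lt_of_le_of_ne ((T.inBox F hF).carrier_subset hx k).2 hk
  -- The vertex of `F` that is high in all free directions except `k`: positive coordinates of `x`
  -- stay positive, and the coordinate `k` stays below its maximum.
  let I : Fin n → ℕ := fun i => F.base i + if i ∈ F.dirs ∧ i ≠ k then 1 else 0
  have hV : (vertex I).IsFaceOf F := by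
    refine ⟨by simp [vertex], fun i => ?_⟩
    simp only [vertex, I]
    by_cases h : i ∈ F.dirs <;> by_cases h' : i = k <;> simp [h, h']
  have hpos : ∀ i, i ≠ k → 0 < x i → 0 < I i := by
    intro i hik hi
    by_cases h : i ∈ F.dirs
    · simp [I, h, hik]
    · have := (hx i).2
      simp only [h, if_false, add_zero] at this
      have : (0 : ℝ) < F.base i := by linarith
      simpa [I, h] using this
  have h1 := vertex_lower hθ hT _ rfl (T.closed F hF _ hV) j k l hjk hkl (hpos j hjk.ne hj)
    (hpos l hkl.ne' hl)
  have h2 := (hx k).1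
  have h3 : F.base k = a k := by simpa [I] using h1
  rw [h3] at h2
  linarith

end Tiling

end Zonogon

/-! ### Tops and bottoms of cubes, and the existence of flips. -/

namespace Zonogon

variable {n : ℕ}

open Face

/-- The facet of `c` orthogonal to the direction `i` that contains the vertex `J`. -/
def facet (c : Face n) (J : Fin n → ℕ) (i : Fin n) : Face n :=
  ⟨Function.update c.base i (J i), c.dirs.erase i⟩

lemma mem_facetsAt {c : Face n} (hc : c.dim = 3) {J : Fin n → ℕ} (hJ : (vertex J).IsFaceOf c)
    {F : Face n} : F ∈ facetsAt c J ↔ F.IsFaceOf c ∧ ∃ i ∈ c.dirs, i ∉ F.dirs ∧ F.base i = J i := by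
  constructor
  · rintro ⟨G, hGc, hG, hJG, hFG⟩
    refine ⟨hFG.trans hGc, ?_⟩
    obtain ⟨i, hic, hiG⟩ : ∃ i ∈ c.dirs, i ∉ G.dirs := by
      by_contra! hcon
      have := Finset.card_le_card (show c.dirs ⊆ G.dirs from hcon)
      simp only [dim] at hG hc
      omega
    refine ⟨i, hic, fun h => hiG (hFG.1 h), ?_⟩
    rcases hFG.2 i with e | ⟨h, -⟩
    · rcases hJG.2 i with e' | ⟨h, -⟩
      · exact e.trans e'.symm
      · exact absurd h hiG
    · exact absurd h hiG
  · rintro ⟨hFc, i, hic, hiF, hi⟩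
    refine ⟨facet c J i, ⟨Finset.erase_subset _ _, fun t => ?_⟩, ?_, ⟨by simp [vertex], fun t => ?_⟩,
      fun t ht => Finset.mem_erase.2 ⟨fun h => hiF (h ▸ ht), hFc.1 ht⟩, fun t => ?_⟩
    · by_cases h : t = i
      · subst h
        rcases hJ.2 t with e | ⟨e1, -, e2⟩
        · left; simpa [facet, vertex] using e
        · right; exact ⟨e1, by simp [facet], by simpa [facet, vertex] using e2⟩
      · left; simp [facet, h]
    · simp only [dim] at hc
      simp [dim, facet, Finset.card_erase_of_mem hic, hc]
    · by_cases h : t = i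
      · subst h; left; simp [facet, vertex]
      · rcases hJ.2 t with e | ⟨e1, e2, e3⟩
        · left; simpa [facet, h] using e
        · right; exact ⟨by simp [facet, h, e1], e2, by simpa [facet, h] using e3⟩
    · by_cases h : t = i
      · subst h; left; simpa [facet] using hi
      · rcases hFc.2 t with e | ⟨e1, e2, e3⟩
        · left; simpa [facet, h] using e
        · right; exact ⟨by simp [facet, h, e1], e2, by simpa [facet, h] using e3⟩

lemma facetsAt_closed {c : Face n} {J : Fin n → ℕ} {F G : Face n} (hG : G ∈ facetsAt c J)
    (h : F.IsFaceOf G) : F ∈ facetsAt c J := by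
  obtain ⟨H, h1, h2, h3, h4⟩ := hG
  exact ⟨H, h1, h2, h3, h.trans h4⟩

lemma mem_support_facetsAt {c : Face n} (hc : c.dim = 3) {J : Fin n → ℕ}
    (hJ : (vertex J).IsFaceOf c) {x : Fin n → ℝ} :
    x ∈ support (facetsAt c J) ↔ x ∈ c.carrier ∧ ∃ i ∈ c.dirs, x i = J i := by
  rw [mem_support]
  constructor
  · rintro ⟨F, hF, hx⟩
    obtain ⟨hFc, i, hic, hiF, hi⟩ := (mem_facetsAt hc hJ).1 hF
    refine ⟨hFc.carrier_subset hx, i, hic, ?_⟩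
    have := hx i
    simp only [hiF, if_false, add_zero, hi] at this
    exact le_antisymm this.2 this.1
  · rintro ⟨hx, i, hic, hi⟩
    refine ⟨minFace x, (mem_facetsAt hc hJ).2 ⟨minFace_isFaceOf hx, i, hic, ?_, ?_⟩,
      relint_subset_carrier _ (mem_relint_minFace (carrier_nonneg hx))⟩
    · simp [minFace, hi]
    · simp [minFace, hi]

/-- A face of a cube that misses a vertex lies in a facet at the antipodal vertex. -/
lemma mem_facetsAt_of_antipodal {c : Face n} (hc : c.dim = 3) {J K : Fin n → ℕ}
    (hJ : (vertex J).IsFaceOf c) (hK : (vertex K).IsFaceOf c)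
    (hJK : ∀ i ∈ c.dirs, J i + K i = 2 * c.base i + 1) {F : Face n} (hF : F.IsFaceOf c)
    (hJF : ¬ (vertex J).IsFaceOf F) : F ∈ facetsAt c K := by
  refine (mem_facetsAt hc hK).2 ⟨hF, ?_⟩
  by_contra! hcon
  refine hJF ⟨by simp [vertex], fun i => ?_⟩
  have h1 := hF.2 i
  have h2 := hJ.2 i
  have h3 := hcon i
  have h4 := hJK i
  have h5 := @hF.1 i
  have h6 := hK.2 i
  simp only [vertex, Finset.notMem_empty, not_false_eq_true, true_and] at *
  by_cases hc : i ∈ c.dirs <;> by_cases hf : i ∈ F.dirs <;>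
    simp only [hc, hf, true_and, false_and, or_false, not_false_eq_true, not_true_eq_false,
      forall_const, ne_eq] at * <;> omega

/-- Moving a point of a cube along a direction pointing to the facets at `J`. -/
lemma exists_push {c : Face n} (hc : c.dim = 3) {J : Fin n → ℕ} (hJ : (vertex J).IsFaceOf c)
    {u : Fin n → ℝ} (hu0 : ∀ i ∉ c.dirs, u i = 0)
    (hu : ∀ i ∈ c.dirs, (0 < u i ∧ J i = c.base i + 1) ∨ (u i < 0 ∧ J i = c.base i))
    {x : Fin n → ℝ} (hx : x ∈ c.carrier) : ∃ t : ℝ, x + t • u ∈ support (facetsAt c J) := by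
  have hne : c.dirs.Nonempty := by
    rw [← Finset.card_pos]; simp only [dim] at hc; omega
  obtain ⟨i₀, hi₀, hmin⟩ := Finset.exists_min_image c.dirs (fun i => (J i - x i) / u i) hne
  -- A ratio test: every coordinate moves towards `J`, and `i₀` is the first to arrive.
  set t := (J i₀ - x i₀) / u i₀ with ht
  have ht0 : 0 ≤ t := by
    have hxi := hx i₀
    simp only [hi₀, if_true] at hxi
    rcases hu i₀ hi₀ with ⟨h1, h2⟩ | ⟨h1, h2⟩
    · exact div_nonneg (by rw [h2]; push_cast; linarith) h1.le
    · exact div_nonneg_of_nonpos (by rw [h2]; linarith) h1.le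
  refine ⟨t, (mem_support_facetsAt hc hJ).2 ⟨fun i => ?_, i₀, hi₀, ?_⟩⟩
  · have hxi := hx i
    simp only [Pi.add_apply, Pi.smul_apply, smul_eq_mul]
    by_cases hi : i ∈ c.dirs
    · simp only [hi, if_true] at hxi ⊢
      have hm := hmin i hi
      rcases hu i hi with ⟨h1, h2⟩ | ⟨h1, h2⟩
      · rw [le_div_iff₀ h1, h2] at hm
        push_cast at hm
        have := mul_nonneg ht0 h1.le
        constructor <;> linarith
      · rw [le_div_iff_of_neg h1, h2] at hm
        have := mul_nonneg ht0 (neg_nonneg.2 h1.le)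
        constructor <;> linarith
    · rw [hu0 i hi, mul_zero, add_zero]; exact hxi
  · have : u i₀ ≠ 0 := by
      rcases hu i₀ hi₀ with ⟨h1, -⟩ | ⟨h1, -⟩
      · exact h1.ne'
      · exact h1.ne
    simp only [Pi.add_apply, Pi.smul_apply, smul_eq_mul, ht]
    rw [div_mul_cancel₀ _ this]; ring

section Cube

variable (I : Fin n → ℕ) {j k l : Fin n} (hjk : j < k) (hkl : k < l)
include hjk hkl

lemma dim_cube : (cube I j k l).dim = 3 :=
  Finset.card_eq_three.2 ⟨j, k, l, hjk.ne, (hjk.trans hkl).ne, hkl.ne, rfl⟩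

lemma bottomVertex_isFaceOf : (vertex (I + Pi.single k 1)).IsFaceOf (cube I j k l) := by
  refine ⟨by simp [vertex], fun t => ?_⟩
  by_cases h : t = k
  · subst h; right; simp [vertex, cube]
  · left; simp [vertex, cube, h]

lemma topVertex_isFaceOf :
    (vertex (I + Pi.single j 1 + Pi.single l 1)).IsFaceOf (cube I j k l) := by
  have hjl := hjk.trans hkl
  refine ⟨by simp [vertex], fun t => ?_⟩
  by_cases h : t = j
  · subst h; right; simp [vertex, cube, hjl.ne]
  by_cases h' : t = l
  · subst h'; right; simp [vertex, cube, hjl.ne']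
  · left; simp [vertex, cube, h, h']

lemma cube_antipodal (i : Fin n) (hi : i ∈ (cube I j k l).dirs) :
    (I + Pi.single j 1 + Pi.single l 1 : Fin n → ℕ) i + (I + Pi.single k 1 : Fin n → ℕ) i =
      2 * (cube I j k l).base i + 1 := by
  have hjl := hjk.trans hkl
  simp only [cube, Finset.mem_insert, Finset.mem_singleton] at hi ⊢
  rcases hi with rfl | rfl | rfl
  · simp [hjk.ne, hjl.ne]; omega
  · simp [hjk.ne', hkl.ne]; omega
  · simp [hkl.ne', hjl.ne']; omega

variable {θ : Fin n → ℝ} (hθ : Admissible θ)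
include hθ

/-- The signs of the circuit point towards the bottom vertex `I + e_k`, and moving along it does not
change the projection. Its negative reaches the top in the same way. -/
lemma exists_mem_bottomFaces {x : Fin n → ℝ} (hx : x ∈ (cube I j k l).carrier) :
    ∃ y ∈ support (bottomFaces I j k l), proj θ y = proj θ x := by
  have hjl := hjk.trans hkl
  have hu0 : ∀ i ∉ (cube I j k l).dirs, circuit θ j k l i = 0 := by
    intro i hi
    simp only [cube, Finset.mem_insert, Finset.mem_singleton, not_or] at hi
    exact circuit_other θ hi.1 hi.2.1 hi.2.2
  obtain ⟨t, ht⟩ := exists_push (dim_cube I hjk hkl) (bottomVertex_isFaceOf I hjk hkl) hu0 (by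
    intro i hi
    simp only [cube, Finset.mem_insert, Finset.mem_singleton] at hi ⊢
    rcases hi with rfl | rfl | rfl
    · right; rw [circuit_left θ hjk hkl]; simp [hjk.ne, hθ.sin_sub_pos hkl]
    · left; rw [circuit_mid θ hjk hkl]; simp [hθ.sin_sub_pos hjl]
    · right; rw [circuit_right θ hjk hkl]; simp [hkl.ne', hθ.sin_sub_pos hjk]) hx
  exact ⟨_, ht, by rw [proj_add, proj_smul, proj_circuit, smul_zero, add_zero]⟩

lemma exists_mem_topFaces {x : Fin n → ℝ} (hx : x ∈ (cube I j k l).carrier) :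
    ∃ y ∈ support (topFaces I j k l), proj θ y = proj θ x := by
  have hjl := hjk.trans hkl
  have hu0 : ∀ i ∉ (cube I j k l).dirs, ((-1 : ℝ) • circuit θ j k l) i = 0 := by
    intro i hi
    simp only [cube, Finset.mem_insert, Finset.mem_singleton, not_or] at hi
    rw [Pi.smul_apply, circuit_other θ hi.1 hi.2.1 hi.2.2, smul_zero]
  obtain ⟨t, ht⟩ := exists_push (dim_cube I hjk hkl) (topVertex_isFaceOf I hjk hkl) hu0 (by
    intro i hi
    simp only [cube, Finset.mem_insert, Finset.mem_singleton] at hi ⊢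
    rw [Pi.smul_apply, smul_eq_mul]
    rcases hi with rfl | rfl | rfl
    · left; rw [circuit_left θ hjk hkl]; simp [hjl.ne, hθ.sin_sub_pos hkl]
    · right; rw [circuit_mid θ hjk hkl]; simp [hkl.ne, hjk.ne', hθ.sin_sub_pos hjl]
    · left; rw [circuit_right θ hjk hkl]; simp [hjl.ne', hθ.sin_sub_pos hjk]) hx
  refine ⟨_, ht, ?_⟩
  rw [proj_add, proj_smul, proj_smul, proj_circuit, smul_zero, smul_zero, add_zero]

/-- If two points of the cube have equal projection, one is larger at `j` and `l` and smaller at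
`k`. It lies strictly off all three bottom facets. -/
lemma injOn_bottomFaces : Set.InjOn (proj θ) (support (bottomFaces I j k l)) := by
  have hc := dim_cube I hjk hkl
  have hK := bottomVertex_isFaceOf I hjk hkl
  have key : ∀ {x y : Fin n → ℝ}, x ∈ support (bottomFaces I j k l) →
      y ∈ support (bottomFaces I j k l) → ∀ j' k' l' : Fin n, j' < k' → k' < l' →
      0 < x j' - y j' → x k' - y k' < 0 → 0 < x l' - y l' → False := by
    intro x y hx hy j' k' l' hjk' hkl' h1 h2 h3
    obtain ⟨hx, i, hi, hxi⟩ := (mem_support_facetsAt hc hK).1 hx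
    obtain ⟨hy, -⟩ := (mem_support_facetsAt hc hK).1 hy
    have hmem : ∀ t, x t - y t ≠ 0 → t = j ∨ t = k ∨ t = l := by
      intro t ht
      by_contra hcon
      have e1 := hx t
      have e2 := hy t
      simp only [cube, Finset.mem_insert, Finset.mem_singleton, hcon, if_false, add_zero] at e1 e2
      exact ht (by linarith [e1.1, e1.2, e2.1, e2.2])
    have hj' : j' = j ∧ k' = k ∧ l' = l := by
      have m1 := hmem j' h1.ne'
      have m2 := hmem k' h2.ne
      have m3 := hmem l' h3.ne'
      simp only [Fin.ext_iff, Fin.lt_def] at *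
      omega
    obtain ⟨rfl, rfl, rfl⟩ := hj'
    have hx1 := hx i
    have hy1 := hy i
    simp only [hi, if_true] at hx1 hy1
    simp only [cube, Finset.mem_insert, Finset.mem_singleton] at hi hx1 hy1
    rcases hi with rfl | rfl | rfl
    · simp [hjk.ne] at hxi; linarith
    · simp at hxi; linarith
    · simp [hkl.ne'] at hxi; linarith
  intro x hx y hy hxy
  by_contra hne
  obtain ⟨j', k', l', hjk', hkl', ⟨h1, h2, h3⟩ | ⟨h1, h2, h3⟩⟩ :=
    hθ.exists_signs_of_proj_eq_zero (d := x - y) (by rw [proj_sub, hxy, sub_self])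
      (sub_ne_zero.2 hne) <;> simp only [Pi.sub_apply] at h1 h2 h3
  · exact key hx hy j' k' l' hjk' hkl' h1 h2 h3
  · exact key hy hx j' k' l' hjk' hkl' (by linarith) (by linarith) (by linarith)

end Cube

namespace Tiling

variable {a : Fin n → ℕ} {θ : Fin n → ℝ} {T : Tiling a θ}

/-- The faces of a tiling at the interior vertex of the top of a cube belong to that top. -/
lemma mem_topFaces_of_vertex (hθ : Admissible θ) {I : Fin n → ℕ} {j k l : Fin n} (hjk : j < k)
    (hkl : k < l) (htop : topFaces I j k l ⊆ T.faces) {G : Face n} (hG : G ∈ T.faces)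
    (hJ : (vertex (I + Pi.single j 1 + Pi.single l 1)).IsFaceOf G) : G ∈ topFaces I j k l := by
  have hjl := hjk.trans hkl
  set J : Fin n → ℕ := I + Pi.single j 1 + Pi.single l 1 with hJdef
  have hJc := topVertex_isFaceOf I hjk hkl
  have hint : proj θ (latticePoint J) ∈ interior (proj θ '' (cube I j k l).carrier) := by
    have hmem := hJc.carrier_subset (latticePoint_mem_vertex J)
    rw [carrier_eq_Icc] at hmem ⊢
    refine hθ.proj_mem_interior hmem hjk hkl ?_ ?_ ?_ <;>
      simp [latticePoint, hJdef, cube, hjl.ne, hjl.ne', hjk.ne', hkl.ne]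
  have hcont : Filter.Tendsto
      (fun t : ℝ => proj θ (latticePoint J + t • (G.center - latticePoint J)))
      (nhdsWithin 0 (Set.Ioi 0)) (nhds (proj θ (latticePoint J))) := by
    refine Filter.Tendsto.mono_left ?_ nhdsWithin_le_nhds
    have : Continuous fun t : ℝ => proj θ (latticePoint J + t • (G.center - latticePoint J)) :=
      (continuous_proj θ).comp (by fun_prop)
    simpa using this.tendsto 0
  obtain ⟨t, ht, ht0, ht1⟩ := Filter.nonempty_of_mem (Filter.inter_mem
    (Filter.mem_map.1 (hcont (mem_interior_iff_mem_nhds.1 hint)))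
    (Ioo_mem_nhdsGT (zero_lt_one (α := ℝ))))
  -- A short step from `J` towards the center of `G` enters the relative interior of `G` while its
  -- projection stays in that of the cube. The top covers this projection, so injectivity identifies
  -- the two points.
  set x := latticePoint J + t • (G.center - latticePoint J) with hx
  have hrel : x ∈ G.relint := by
    intro i
    simp only [hx, Pi.add_apply, Pi.smul_apply, Pi.sub_apply, smul_eq_mul, latticePoint, center]
    rcases hJ.2 i with e | ⟨e1, -, e2⟩
    · have e' : (J i : ℝ) = G.base i := by exact_mod_cast e
      rw [e']
      constructor <;> intro h <;> simp only [h, if_true, if_false]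
      · ring
      · constructor <;> linarith
    · have e' : (J i : ℝ) = G.base i + 1 := by exact_mod_cast e2
      rw [e']
      simp only [e1, not_true_eq_false, false_imp_iff, true_and, if_true, forall_const]
      constructor <;> linarith
  obtain ⟨z, hz, hzx⟩ : proj θ x ∈ proj θ '' (cube I j k l).carrier := ht
  obtain ⟨y, hy, hyz⟩ := exists_mem_topFaces I hjk hkl hθ hz
  obtain ⟨S, hS, hyS⟩ := mem_support.1 hy
  have hxy : y = x := eq_of_proj_eq (htop hS) hG hyS (relint_subset_carrier _ hrel)
    (hyz.trans hzx)
  exact facetsAt_closed hS (isFaceOf_of_mem_relint hrel (hxy ▸ hyS))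

/-- Top and bottom have the same projection as the whole cube, so the flip preserves covering.
Injectivity holds because the rest of the tiling meets the top only in faces that also belong to the
bottom. -/
lemma exists_downwardFlip (hθ : Admissible θ) {I : Fin n → ℕ} {j k l : Fin n} (hjk : j < k)
    (hkl : k < l) (hbox : (cube I j k l).InBox a) (htop : topFaces I j k l ⊆ T.faces) :
    ∃ T' : Tiling a θ, T.DownwardFlip T' := by
  have hc := dim_cube I hjk hkl
  have hJ := topVertex_isFaceOf I hjk hkl
  have hK := bottomVertex_isFaceOf I hjk hkl
  have hanti := cube_antipodal I hjk hkl
  have htopc : ∀ {F}, F ∈ topFaces I j k l → F.IsFaceOf (cube I j k l) :=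
    fun h => ((mem_facetsAt hc hJ).1 h).1
  have hbotc : ∀ {F}, F ∈ bottomFaces I j k l → F.IsFaceOf (cube I j k l) :=
    fun h => ((mem_facetsAt hc hK).1 h).1
  -- A shared face misses the inner vertex of the top, since every face of the tiling at that vertex
  -- is a top face; hence it lies in a facet at the antipodal vertex.
  have hshared : ∀ {G F : Face n}, G ∈ T.faces → G ∉ topFaces I j k l → F.IsFaceOf G →
      F ∈ topFaces I j k l → F ∈ bottomFaces I j k l := fun hG hGt hFG hF =>
    mem_facetsAt_of_antipodal hc hJ hK hanti (htopc hF) fun h =>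
      hGt (mem_topFaces_of_vertex hθ hjk hkl htop hG (h.trans hFG))
  -- Lift the bottom point to the top, where it must coincide with `x`. The minimal face of `x` is
  -- then shared, and injectivity on the bottom finishes.
  have hmix : ∀ {x y : Fin n → ℝ} {F : Face n}, F ∈ T.faces → F ∉ topFaces I j k l →
      x ∈ F.carrier → y ∈ support (bottomFaces I j k l) → proj θ x = proj θ y → x = y := by
    intro x y F hF hFt hx hy hxy
    obtain ⟨z, hz, hzy⟩ := exists_mem_topFaces I hjk hkl hθ
      ((mem_support_facetsAt hc hK).1 hy).1
    obtain ⟨S, hS, hzS⟩ := mem_support.1 hz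
    have hzx : z = x := eq_of_proj_eq (htop hS) hF hzS hx (hzy.trans hxy.symm)
    subst hzx
    have hmin := hshared hF hFt (minFace_isFaceOf hx) (facetsAt_closed hS (minFace_isFaceOf hzS))
    exact injOn_bottomFaces I hjk hkl hθ (mem_support.2 ⟨_, hmin,
      relint_subset_carrier _ (mem_relint_minFace (carrier_nonneg hx))⟩) hy hxy
  refine ⟨ofBijOn ((T.faces \ topFaces I j k l) ∪ bottomFaces I j k l) ?_ ?_ ?_ ?_ ⟨?_, ?_, ?_⟩,
    I, j, k, l, hjk, hkl, hbox, htop, rfl⟩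
  · rintro F (⟨hF, -⟩ | hF)
    · exact T.inBox F hF
    · exact (hbotc hF).inBox hbox
  · rintro G (⟨hG, hGt⟩ | hG) F hFG
    · by_cases hF : F ∈ topFaces I j k l
      · exact Or.inr (hshared hG hGt hFG hF)
      · exact Or.inl ⟨T.closed G hG F hFG, hF⟩
    · exact Or.inr (facetsAt_closed hG hFG)
  · rintro F (⟨hF, -⟩ | ⟨G, -, hG, -, hFG⟩)
    · exact T.dim_le F hF
    · exact hG ▸ hFG.dim_le
  · have hv : vertex (I + Pi.single k 1) ∈ bottomFaces I j k l :=
      (mem_facetsAt hc hK).2 ⟨hK, j, by simp [cube], by simp [vertex], rfl⟩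
    obtain ⟨G, h1, h2, h3, h4⟩ := hv
    exact ⟨G, Or.inr ⟨G, h1, h2, h3, IsFaceOf.refl G⟩, h2⟩
  · intro x hx
    obtain ⟨F, hF, hx⟩ := mem_support.1 hx
    refine ⟨x, ?_, rfl⟩
    rcases hF with ⟨hF, -⟩ | hF
    · exact (T.inBox F hF).carrier_subset hx
    · exact ((hbotc hF).inBox hbox).carrier_subset hx
  · intro x hx y hy hxy
    obtain ⟨F, hF, hx⟩ := mem_support.1 hx
    obtain ⟨G, hG, hy⟩ := mem_support.1 hy
    rcases hF with ⟨hF, hFt⟩ | hF <;> rcases hG with ⟨hG, hGt⟩ | hG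
    · exact eq_of_proj_eq hF hG hx hy hxy
    · exact hmix hF hFt hx (mem_support.2 ⟨G, hG, hy⟩) hxy
    · exact (hmix hG hGt hy (mem_support.2 ⟨F, hF, hx⟩) hxy.symm).symm
    · exact injOn_bottomFaces I hjk hkl hθ (mem_support.2 ⟨F, hF, hx⟩)
        (mem_support.2 ⟨G, hG, hy⟩) hxy
  · intro p hp
    obtain ⟨x, hx, rfl⟩ := T.surjOn hp
    obtain ⟨F, hF, hxF⟩ := mem_support.1 hx
    by_cases hFt : F ∈ topFaces I j k l
    · obtain ⟨y, hy, hyx⟩ := exists_mem_bottomFaces I hjk hkl hθ ((htopc hFt).carrier_subset hxF)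
      obtain ⟨G, hG, hyG⟩ := mem_support.1 hy
      exact ⟨y, mem_support.2 ⟨G, Or.inr hG, hyG⟩, hyx⟩
    · exact ⟨x, mem_support.2 ⟨F, Or.inl ⟨hF, hFt⟩, hxF⟩, rfl⟩

lemma exists_downwardFlip_of_nonempty (hθ : Admissible θ) (h : T.fundamentalForest.Nonempty) :
    ∃ T' : Tiling a θ, T.DownwardFlip T' := by
  obtain ⟨_, I, j, rfl, hE, hfr, hu⟩ := h
  obtain ⟨B, j, k, l, hjk, hkl, hF, h1, h2, h3⟩ := exists_three_squares hθ _ rfl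
    (isForestEdge_of_unique hθ hE (exists_proj_mem_interior hE hfr) hu)
  have hjl := hjk.trans hkl
  have hc := dim_cube B hjk hkl
  have hJ := topVertex_isFaceOf B hjk hkl
  refine exists_downwardFlip hθ (I := B) hjk hkl ?_ ?_
  · intro i
    have e1 := T.inBox _ hF.edge_mem i
    simp only [edge, cube, Finset.mem_singleton, Finset.mem_insert, Pi.add_apply,
      Pi.single_apply] at e1 ⊢
    by_cases ij : i = j
    · subst ij; simp [hjk.ne, hjl.ne] at e1 ⊢; omega
    by_cases ik : i = k
    · subst ik; simp [ij, hkl.ne] at e1 ⊢; omega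
    by_cases il : i = l
    · subst il; simp [ij, ik] at e1 ⊢; omega
    simp [ij, ik, il] at e1 ⊢; omega
  · intro F hF
    obtain ⟨hFc, i, hi, hiF, hiJ⟩ := (mem_facetsAt hc hJ).1 hF
    have hdir : ∀ {u v : Fin n}, (∀ t ∈ F.dirs, t = u ∨ t = v ∨ t = i) →
        F.dirs ⊆ {u, v} := by
      intro u v h t ht
      have : t ≠ i := fun e => hiF (e ▸ ht)
      rcases h t ht with e | e | e
      · simp [e]
      · simp [e]
      · exact absurd e this
    have hd : ∀ t ∈ F.dirs, t = j ∨ t = k ∨ t = l := fun t ht => by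
      simpa [cube] using hFc.1 ht
    have hb := hFc.2
    simp only [cube, Finset.mem_insert, Finset.mem_singleton] at hi hb
    -- The coordinate frozen at the inner top vertex decides which of the three squares contains
    -- `F`.
    rcases hi with rfl | rfl | rfl
    · refine T.closed _ h2 F ⟨hdir fun t ht => ?_, fun t => ?_⟩
      · have := hd t ht; tauto
      · by_cases ht : t = i
        · subst ht; left; simpa [square, hjl.ne] using hiJ
        · simpa [square, ht] using hb t
    · refine T.closed _ h1 F ⟨hdir fun t ht => ?_, fun t => ?_⟩
      · have := hd t ht; tauto
      · by_cases ht : t = i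
        · subst ht; left; simpa [square, hjk.ne', hkl.ne] using hiJ
        · simpa [square, ht] using hb t
    · refine T.closed _ h3 F ⟨hdir fun t ht => ?_, fun t => ?_⟩
      · have := hd t ht; tauto
      · by_cases ht : t = i
        · subst ht; left; simpa [square, hjl.ne'] using hiJ
        · simpa [square, ht] using hb t

/-- The edge in direction `k` at the inner vertex of the top lies in the two top squares that have
it as an upper edge, so it is a forest edge. -/
lemma nonempty_of_downwardFlip (hθ : Admissible θ) {T' : Tiling a θ} (h : T.DownwardFlip T') :
    T.fundamentalForest.Nonempty := by
  obtain ⟨I, j, k, l, hjk, hkl, -, htop, -⟩ := h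
  have hjl := hjk.trans hkl
  have hc := dim_cube I hjk hkl
  have hJ := topVertex_isFaceOf I hjk hkl
  refine ⟨_, IsForestEdge.mem_fundamentalForest (I := I + Pi.single j 1 + Pi.single l 1) (j := k)
    hθ ⟨⟨l, hkl, I + Pi.single j 1, rfl, htop ?_⟩,
      j, hjk, I + Pi.single l 1, add_right_comm _ _ _, htop ?_⟩⟩
  · refine (mem_facetsAt hc hJ).2 ⟨⟨by simp [square, cube], fun t => ?_⟩,
      j, by simp [cube], by simp [square, hjk.ne, hjl.ne], by simp [square, hjl.ne]⟩
    by_cases h : t = j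
    · subst h; right; simp [square, cube, hjk.ne, hjl.ne]
    · left; simp [square, cube, h]
  · refine (mem_facetsAt hc hJ).2 ⟨⟨?_, fun t => ?_⟩,
      l, by simp [cube], by simp [square, hkl.ne', hjl.ne'], by simp [square, hjl.ne']⟩
    · intro t; simp only [square, cube, Finset.mem_insert, Finset.mem_singleton]; tauto
    by_cases h : t = l
    · subst h; right; simp [square, cube, hkl.ne', hjl.ne']
    · left; simp [square, cube, h]

/-! ### Height and termination. -/

lemma finite_vertices (T : Tiling a θ) : {I : Fin n → ℕ | vertex I ∈ T.faces}.Finite := by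
  refine (Set.finite_Icc (0 : Fin n → ℕ) a).subset fun I hI => ⟨fun i => Nat.zero_le _, fun i => ?_⟩
  simpa [vertex] using T.inBox _ hI i

/-- The total height of the vertices of a tiling. -/
def height (T : Tiling a θ) : ℕ := ∑ I ∈ T.finite_vertices.toFinset, ∑ i, I i

lemma height_lt {T' : Tiling a θ} (h : T.DownwardFlip T') : T'.height < T.height := by
  obtain ⟨I, j, k, l, hjk, hkl, -, htop, hT'⟩ := h
  have hjl := hjk.trans hkl
  have hc := dim_cube I hjk hkl
  have hJ := topVertex_isFaceOf I hjk hkl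
  have hK := bottomVertex_isFaceOf I hjk hkl
  have hanti := cube_antipodal I hjk hkl
  set J : Fin n → ℕ := I + Pi.single j 1 + Pi.single l 1 with hJdef
  set K : Fin n → ℕ := I + Pi.single k 1 with hKdef
  have hJtop : vertex J ∈ topFaces I j k l :=
    (mem_facetsAt hc hJ).2 ⟨hJ, j, by simp [cube], by simp [vertex], rfl⟩
  have hJbot : vertex J ∉ bottomFaces I j k l := by
    intro h
    obtain ⟨-, i, hi, -, e⟩ := (mem_facetsAt hc hK).1 h
    have e' : J i = K i := e
    have := hanti i hi
    omega
  -- The flip trades the vertex `J` for `K`; the other vertices of the bottom already belong to the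
  -- top. Since `J` has coordinate sum one larger than `K`, this inclusion suffices.
  have hsub : T'.finite_vertices.toFinset ⊆
      insert K (T.finite_vertices.toFinset.erase J) := by
    intro V hV
    simp only [Set.Finite.mem_toFinset, Set.mem_ofPred_eq, Finset.mem_insert, Finset.mem_erase]
      at hV ⊢
    rw [hT'] at hV
    rcases hV with ⟨hV, hVt⟩ | hV
    · exact Or.inr ⟨fun e => hVt (e ▸ hJtop), hV⟩
    · have hVJ : V ≠ J := fun e => hJbot (e ▸ hV)
      by_cases hKV : (vertex K).IsFaceOf (vertex V)
      · left
        funext i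
        rcases hKV.2 i with e | ⟨e, -⟩
        · exact e.symm
        · simp [vertex] at e
      · refine Or.inr ⟨hVJ, htop ?_⟩
        exact mem_facetsAt_of_antipodal hc hK hJ (fun i hi => by rw [add_comm]; exact hanti i hi)
          ((mem_facetsAt hc hK).1 hV).1 hKV
  have hJmem : J ∈ T.finite_vertices.toFinset := by
    simpa using htop hJtop
  have h1 : T'.height ≤ ∑ V ∈ insert K (T.finite_vertices.toFinset.erase J), ∑ i, V i :=
    Finset.sum_le_sum_of_subset hsub
  have h2 : ∑ V ∈ insert K (T.finite_vertices.toFinset.erase J), ∑ i, V i ≤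
      ∑ i, K i + ∑ V ∈ T.finite_vertices.toFinset.erase J, ∑ i, V i := by
    by_cases hmem : K ∈ T.finite_vertices.toFinset.erase J
    · rw [Finset.insert_eq_of_mem hmem]; omega
    · rw [Finset.sum_insert hmem]
  have h3 : ∑ i, J i + ∑ V ∈ T.finite_vertices.toFinset.erase J, ∑ i, V i = T.height :=
    Finset.add_sum_erase _ (fun V => ∑ i, V i) hJmem
  have h4 : ∑ i, K i < ∑ i, J i := by
    simp [hJdef, hKdef, Finset.sum_add_distrib]
  omega

lemma exists_terminal (T : Tiling a θ) : ∃ T₁ : Tiling a θ,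
    Relation.ReflTransGen DownwardFlip T T₁ ∧ ¬ ∃ T', T₁.DownwardFlip T' := by
  induction h : T.height using Nat.strong_induction_on generalizing T with
  | _ N ih =>
  by_cases hT : ∃ T', T.DownwardFlip T'
  · obtain ⟨T', hT'⟩ := hT
    obtain ⟨T₁, h1, h2⟩ := ih _ (h ▸ height_lt hT') T' rfl
    exact ⟨T₁, Relation.ReflTransGen.head hT' h1, h2⟩
  · exact ⟨T, .refl, hT⟩

end Tiling

end Zonogon

end

theorem proposition3p7 (n : ℕ) (hn : 3 ≤ n) (a : Fin n → ℕ) (ha : ∀ i, 0 < a i)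
    (θ : Fin n → ℝ) (hθ : StrictMono θ) (hθ0 : ∀ i, 0 < θ i) (hθπ : ∀ i, θ i < Real.pi) :
    ∃ Tmin : Zonogon.Tiling a θ,
      -- `Tmin` is the only tiling on which no downward flip can be performed
      (∀ T : Zonogon.Tiling a θ, (¬ ∃ T' : Zonogon.Tiling a θ, T.DownwardFlip T') ↔ T = Tmin) ∧
      -- `Tmin` is the only tiling with empty fundamental forest
      (∀ T : Zonogon.Tiling a θ, T.fundamentalForest = ∅ ↔ T = Tmin) ∧
      -- there is no infinite sequence of downward flips
      (¬ ∃ t : ℕ → Zonogon.Tiling a θ, ∀ i, (t i).DownwardFlip (t (i + 1))) ∧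
      -- a finite sequence of downward flips that cannot be continued ends at `Tmin`
      (∀ (m : ℕ) (t : ℕ → Zonogon.Tiling a θ), (∀ i < m, (t i).DownwardFlip (t (i + 1))) →
        (¬ ∃ T' : Zonogon.Tiling a θ, (t m).DownwardFlip T') → t m = Tmin) ∧
      -- every tiling is joined to `Tmin` by a sequence of downward flips
      (∀ T : Zonogon.Tiling a θ, Relation.ReflTransGen Zonogon.Tiling.DownwardFlip T Tmin) ∧
      -- the flip graph is connected
      (Zonogon.flipGraph a θ).Connected := by
  have hadm : Zonogon.Admissible θ := ⟨hθ, hθ0, hθπ⟩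
  let Tmin := Zonogon.lowestTiling hn a ha hadm
  have hflip : ∀ T : Zonogon.Tiling a θ,
      (¬ ∃ T' : Zonogon.Tiling a θ, T.DownwardFlip T') ↔ T.fundamentalForest = ∅ := by
    intro T
    rw [← Set.not_nonempty_iff_eq_empty, not_iff_not]
    exact ⟨fun ⟨_, h⟩ => Zonogon.Tiling.nonempty_of_downwardFlip hadm h,
      Zonogon.Tiling.exists_downwardFlip_of_nonempty hadm⟩
  have huniq : ∀ T : Zonogon.Tiling a θ, T.fundamentalForest = ∅ → T = Tmin := fun T hT =>
    Zonogon.Tiling.eq_of_faces_subset (Zonogon.Tiling.faces_subset_lowerFaces hadm hT)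
  -- The forest of `Tmin` need not be computed: some terminal tiling has empty forest, and by
  -- uniqueness it is `Tmin`.
  have hmin : Tmin.fundamentalForest = ∅ := by
    obtain ⟨T₁, -, h⟩ := Tmin.exists_terminal
    have h' := (hflip T₁).1 h
    exact huniq T₁ h' ▸ h'
  have hforest : ∀ T : Zonogon.Tiling a θ, T.fundamentalForest = ∅ ↔ T = Tmin := fun T =>
    ⟨huniq T, fun h => h ▸ hmin⟩
  have hpath : ∀ T : Zonogon.Tiling a θ,
      Relation.ReflTransGen Zonogon.Tiling.DownwardFlip T Tmin := by
    intro T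
    obtain ⟨T₁, h1, h2⟩ := T.exists_terminal
    exact huniq T₁ ((hflip T₁).1 h2) ▸ h1
  refine ⟨Tmin, fun T => (hflip T).trans (hforest T), hforest, ?_, ?_, hpath, ?_⟩
  · rintro ⟨t, ht⟩
    have hle : ∀ i, (t i).height + i ≤ (t 0).height := by
      intro i
      induction i with
      | zero => exact le_rfl
      | succ i ih =>
        have := Zonogon.Tiling.height_lt (ht i)
        omega
    have := hle ((t 0).height + 1)
    omega
  · intro m t _ h
    exact huniq _ ((hflip _).1 h)
  · have hreach : ∀ T : Zonogon.Tiling a θ, (Zonogon.flipGraph a θ).Reachable T Tmin := by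
      intro T
      refine Relation.ReflTransGen.head_induction_on (hpath T) .rfl fun {T T'} h _ ih => ?_
      refine SimpleGraph.Reachable.trans (SimpleGraph.Adj.reachable ?_) ih
      refine (SimpleGraph.fromRel_adj _ _ _).2 ⟨fun e => ?_, Or.inl (Or.inl h)⟩
      have := Zonogon.Tiling.height_lt h
      rw [e] at this
      exact lt_irrefl _ this
    have : Nonempty (Zonogon.Tiling a θ) := ⟨Tmin⟩
    exact ⟨fun T T' => (hreach T).trans (hreach T').symm⟩
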